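/- Let $\mathcal T$ be a triangulated category with small coproducts, with shift functor $\Sigma$, and let $\mathcal T^c\subseteq\mathcal T$ be the full subcategory of compact objects, i.e. of the objects $c$ such that $\mathrm{Hom}(c,-)$ preserves coproducts. Let $\mathcal A\subseteq\mathcal T^c$ be an essentially small full subcategory with $\Sigma\mathcal A\subseteq\mathcal A$. Let $\mathrm{Coprod}(\mathcal A)$ be the smallest full subcategory of $\mathcal T$ that contains $\mathcal A$ and is closed under extensions and under small coproducts, and let $\mathrm{Coprod}(\mathcal A)^\perp$ be the full subcategory of all $x\in\mathcal T$ with $\mathrm{Hom}(a,x)=0$ for every $a\in\mathrm{Coprod}(\mathcal A)$. Then $(\mathcal T_{\mathcal A}^{\leq 0},\mathcal T_{\mathcal A}^{\geq 1})=(\mathrm{Coprod}(\mathcal A),\mathrm{Coprod}(\mathcal A)^\perp)$ is a t-structure on $\mathcal T$, and its heart $\mathcal T_{\mathcal A}^{\heartsuit}=\mathcal T_{\mathcal A}^{\leq 0}\cap\mathcal T_{\mathcal A}^{\geq 0}$ is a locally finitely presented Grothendieck abelian category: it is abelian, has small coproducts, exact filtered colimits and a set of generators, its finitely presented objects (those $b$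 for which $\mathrm{Hom}(b,-)$ commutes with filtered colimits) form an essentially small full subcategory, and every object is a filtered colimit of finitely presented objects. Moreover, let $\mathcal H^0_{\mathcal A}\colon\mathcal T\to\mathcal T_{\mathcal A}^{\heartsuit}$, $X\mapsto (X^{\leq 0})^{\geq 0}$, be the cohomology functor of this t-structure. An object of $\mathcal T_{\mathcal A}^{\heartsuit}$ is finitely presented if and only if it is isomorphic to $\mathcal H^0_{\mathcal A}(c)$ for some $c\in\mathcal T^c\cap\mathcal T_{\mathcal A}^{\leq 0}$. -/

import Mathlib

open CategoryTheory CategoryTheory.Limits CategoryTheory.Pretriangulated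
open CategoryTheory.Triangulated

universe v u

namespace TriangulatedHeart

section Compact

variable (C : Type u) [Category.{v} C] [Preadditive C]

/-- An object `c` is compact if the functor `Hom(c, -)`, with values in abelian groups, preserves
those small coproducts that exist in `C`. -/
def compact : ObjectProperty C := fun c =>
  ∀ J : Type v, PreservesColimitsOfShape (Discrete J) (preadditiveCoyoneda.obj (Opposite.op c))

end Compact

section Generation

variable {C : Type u} [Category.{v} C] [HasZeroObject C] [HasShift C ℤ] [Preadditive C]
  [∀ n : ℤ, (shiftFunctor C n).Additive] [Pretriangulated C]

/-- `coprod P` is the smallest full subcategory of `C` which contains `P` and is closed under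
extensions and under small coproducts (see `isLeast_coprod`). -/
inductive coprod (P : ObjectProperty C) : ObjectProperty C
  | of_mem (X : C) (hX : P X) : coprod P X
  | of_triangle (T : Triangle C) (hT : T ∈ distTriang C)
      (h₁ : coprod P T.obj₁) (h₃ : coprod P T.obj₃) : coprod P T.obj₂
  | of_coproduct (J : Type v) (X : J → C) (c : Cofan X) (hc : IsColimit c)
      (hX : ∀ j, coprod P (X j)) : coprod P c.pt

/-- `coprod P` is the least `S` such that `P ⊆ S`, `S * S ⊆ S` and `Add(S) ⊆ S`. -/
theorem isLeast_coprod (P : ObjectProperty C) :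
    IsLeast {S : ObjectProperty C | P ≤ S ∧ S.extensionProduct S ≤ S ∧
      ∀ J : Type v, S.colimitsOfShape (Discrete J) ≤ S} (coprod P) := by
  refine ⟨⟨fun X hX => .of_mem X hX, ?_, ?_⟩, ?_⟩
  · rintro X ⟨Y, Z, f, g, h, hT, hY, hZ⟩
    exact coprod.of_triangle (Triangle.mk f g h) hT hY hZ
  · rintro J X ⟨p⟩
    have e : Discrete.functor (fun j => p.diag.obj ⟨j⟩) ≅ p.diag :=
      Discrete.natIso (fun _ => Iso.refl _)
    exact coprod.of_coproduct J _ ((Cocone.precompose e.hom).obj (Cocone.mk X p.ι))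
      ((IsColimit.precomposeHomEquiv e _).symm p.isColimit) (fun j => p.prop_diag_obj ⟨j⟩)
  · rintro S ⟨hP, hE, hJ⟩ X hX
    induction hX with
    | of_mem X hX => exact hP X hX
    | of_triangle T hT _ _ h₁ h₃ =>
      exact hE _ ⟨T.obj₁, T.obj₃, T.mor₁, T.mor₂, T.mor₃, hT, h₁, h₃⟩
    | of_coproduct J X c hc _ h =>
      exact hJ J _ ⟨{ diag := _, ι := c.ι, isColimit := hc, prop_diag_obj := fun j => h j.as }⟩

end Generation

section Cohomology

variable {C : Type u} [Category.{v} C] [HasZeroObject C] [HasShift C ℤ] [Preadditive C]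
  [∀ n : ℤ, (shiftFunctor C n).Additive] [Pretriangulated C] [IsTriangulated C]

/-- The heart of a t-structure `t`, as a full subcategory. -/
abbrev Heart (t : TStructure C) := t.heart.FullSubcategory

/-- The cohomology functor `H⁰` of a t-structure: the truncation `X ↦ (X^{≤ 0})^{≥ 0}`, viewed as
a functor to the heart. -/
noncomputable def cohomologyZero (t : TStructure C) : C ⥤ Heart t :=
  t.heart.lift (t.truncGELE 0 0) fun _ =>
    (t.mem_heart_iff _).2 ⟨inferInstance, inferInstance⟩

end Cohomology

end TriangulatedHeart

namespace TriangulatedHeart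

/-! ### Compact objects -/

/-! ### Exactness of Hom on a distinguished triangle -/

section Triangle

variable {C : Type u} [Category.{v} C] [HasZeroObject C] [HasShift C ℤ] [Preadditive C]
  [∀ n : ℤ, (shiftFunctor C n).Additive] [Pretriangulated C]
  {X Y Z : C} {f : X ⟶ Y} {g : Y ⟶ Z} {h : Z ⟶ X⟦(1 : ℤ)⟧}

/-! Write P for the generating class. To truncate X, start with a coproduct of generators covering
all maps from generators to X, and repeatedly attach coproducts of generators so as to kill every
map a → Y[1] that dies in X[1]. The telescope of this sequence lies in `coprod P`. Maps from compact
objects to the telescope come from a finite stage, so the cone of telescope → X is right orthogonal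
to P, hence to `coprod P` (`exists_triangle_coprod_rightOrthogonal`).

The key to the heart is `FactorsCompactly`: a map from a compact object to an object ≤ 0 factors
through a compact object ≤ 0, and even through an iterated extension of generators and zero objects
(`IsCompactExtension.factorsThrough`). A colimit in the heart is the truncation of the cone of
`relations K`, so a map from a compact c to it need not lift to the coproduct of the values.
Factorization turns the obstructions into compact objects ≤ 0 or ≤ -1; their maps to the diagram die
at a later index by filteredness, or at once by orthogonality. Hence maps from c commute with
filtered colimits in the heart, and truncations of compact objects that lie in the heart are
finitely presented.

The truncations of iterated extensions, taken up to isomorphism, form a small separating class of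
such objects. Exactness of filtered colimits and local finite presentability follow. Every finitely
presented object lies in the closure of this class under finite colimits, so it remains to see that
the objects H⁰(c) are closed under finite coproducts and cokernels; for a cokernel, one lifts the
map to compact objects and truncates its cone. -/

lemma mor₁_comp_mor₂ (hT : Triangle.mk f g h ∈ distTriang C) : f ≫ g = 0 :=
  comp_distTriang_mor_zero₁₂ _ hT

lemma mor₁_comp_mor₂_assoc (hT : Triangle.mk f g h ∈ distTriang C) {A : C} (k : Z ⟶ A) :
    f ≫ g ≫ k = 0 ≫ k := by
  rw [← Category.assoc, mor₁_comp_mor₂ hT]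

lemma mor₂_comp_mor₃ (hT : Triangle.mk f g h ∈ distTriang C) : g ≫ h = 0 :=
  comp_distTriang_mor_zero₂₃ _ hT

lemma mor₂_comp_mor₃_assoc (hT : Triangle.mk f g h ∈ distTriang C) {A : C}
    (k : X⟦(1 : ℤ)⟧ ⟶ A) : g ≫ h ≫ k = 0 ≫ k := by
  rw [← Category.assoc, mor₂_comp_mor₃ hT]

lemma mor₃_comp_shift_mor₁ (hT : Triangle.mk f g h ∈ distTriang C) : h ≫ f⟦(1 : ℤ)⟧' = 0 :=
  comp_distTriang_mor_zero₃₁ _ hT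

lemma exists_lift_mor₁ (hT : Triangle.mk f g h ∈ distTriang C) {A : C} (x : A ⟶ Y)
    (hx : x ≫ g = 0) : ∃ y : A ⟶ X, y ≫ f = x :=
  (Triangle.coyoneda_exact₂ _ hT x hx).imp fun _ h => h.symm

lemma exists_lift_mor₂ (hT : Triangle.mk f g h ∈ distTriang C) {A : C} (x : A ⟶ Z)
    (hx : x ≫ h = 0) : ∃ y : A ⟶ Y, y ≫ g = x :=
  (Triangle.coyoneda_exact₃ _ hT x hx).imp fun _ h => h.symm

lemma exists_desc_mor₂ (hT : Triangle.mk f g h ∈ distTriang C) {A : C} (x : Y ⟶ A)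
    (hx : f ≫ x = 0) : ∃ y : Z ⟶ A, g ≫ y = x :=
  (Triangle.yoneda_exact₂ _ hT x hx).imp fun _ h => h.symm

lemma exists_desc_mor₃ (hT : Triangle.mk f g h ∈ distTriang C) {A : C} (x : Z ⟶ A)
    (hx : g ≫ x = 0) : ∃ y : X⟦(1 : ℤ)⟧ ⟶ A, h ≫ y = x :=
  (Triangle.yoneda_exact₃ _ hT x hx).imp fun _ h => h.symm

lemma exists_desc_mor₁ (hT : Triangle.mk f g h ∈ distTriang C) {A : C} (x : X ⟶ A)
    (hx : h ≫ x⟦(1 : ℤ)⟧' = 0) : ∃ y : Y ⟶ A, f ≫ y = x := by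
  obtain ⟨y', hy'⟩ := Triangle.yoneda_exact₃ _ (rot_of_distTriang _ hT) (x⟦(1 : ℤ)⟧') hx
  obtain ⟨y : Y ⟶ A, rfl⟩ := (shiftFunctor C (1 : ℤ)).map_surjective y'
  -- The third map of the rotated triangle is `-f⟦1⟧'`, whence the sign.
  refine ⟨-y, (shiftFunctor C (1 : ℤ)).map_injective ?_⟩
  refine Eq.trans ?_ hy'.symm
  rw [Functor.map_comp, Functor.map_neg, Preadditive.comp_neg]
  exact (Preadditive.neg_comp (f⟦(1 : ℤ)⟧') (y⟦(1 : ℤ)⟧')).symm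

end Triangle

/-! ### Compactness and the shift -/

section Shift

variable {C : Type u} [Category.{v} C] [Preadditive C] [HasShift C ℤ]
  [∀ n : ℤ, (shiftFunctor C n).Additive]

/-- By adjunction, Hom(c[n], -) is Hom(c, -) after the shift by -n, an equivalence, which preserves
coproducts. -/
lemma compact_shift {c : C} (hc : compact C c) (n : ℤ) : compact C (c⟦n⟧) := by
  intro J
  have := hc J
  let adj := (shiftEquiv C n).toAdjunction
  let e : shiftFunctor C (-n) ⋙ preadditiveCoyoneda.obj (Opposite.op c) ≅
      preadditiveCoyoneda.obj (Opposite.op (c⟦n⟧)) :=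
    NatIso.ofComponents (fun X => (AddEquiv.mk' (adj.homEquiv c X).symm (fun f g => by
      simp only [adj.homEquiv_counit]
      exact (congrArg (· ≫ adj.counit.app X) ((shiftFunctor C n).map_add)).trans
        (Preadditive.add_comp _ _ _ _ _ _))).toAddCommGrpIso) (fun {X Y} f => by
        ext g
        exact adj.homEquiv_naturality_right_symm g f)
  exact preservesColimitsOfShape_of_natIso e

/-- A morphism from a compact object to a shifted object is, up to isomorphism, the shift of a
morphism from a compact object. -/
lemma compact.exists_unshift {c : C} (hc : compact C c) {X : C} (x : c ⟶ X⟦(1 : ℤ)⟧) :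
    ∃ (c' : C) (_ : compact C c') (e : c ≅ c'⟦(1 : ℤ)⟧) (x' : c' ⟶ X), x = e.hom ≫ x'⟦1⟧' := by
  let e : c⟦(-1 : ℤ)⟧⟦(1 : ℤ)⟧ ≅ c := (shiftEquiv C (1 : ℤ)).counitIso.app c
  exact ⟨_, compact_shift hc (-1), e.symm, (shiftFunctor C (1 : ℤ)).preimage (e.hom ≫ x),
    by simp⟩

end Shift

/-! ### Compactness as finite support of maps into coproducts -/

section Compact

open scoped Classical

/-- A colimit of abelian groups is generated by the images of the components. -/
lemma closure_iUnion_range_eq_top {J : Type v} {G : J → AddCommGrpCat.{v}} (t : Cofan G)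
    (ht : IsColimit t) : AddSubgroup.closure (⋃ j, Set.range (t.inj j).hom) = ⊤ := by
  set S := AddSubgroup.closure (⋃ j, Set.range (t.inj j).hom) with hS
  -- The quotient map by the generated subgroup vanishes on each component, hence is zero.
  have h : AddCommGrpCat.ofHom (QuotientAddGroup.mk' S) = 0 := by
    refine Cofan.IsColimit.hom_ext ht _ _ fun j => ?_
    ext a
    have : (t.inj j).hom a ∈ S :=
      AddSubgroup.subset_closure (Set.mem_iUnion.2 ⟨j, a, rfl⟩)
    simpa using (QuotientAddGroup.eq_zero_iff _).2 this
  rw [eq_top_iff]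
  intro a _
  have := congr($(h).hom a)
  simpa using this

variable {C : Type u} [Category.{v} C] [Preadditive C] [HasCoproducts.{v} C]

/-- The idempotent endomorphism of a coproduct which projects onto a finite subset of summands. -/
noncomputable def sigmaPart {J : Type v} (X : J → C) (S : Finset J) : ∐ X ⟶ ∐ X :=
  ∑ j ∈ S, Sigma.π X j ≫ Sigma.ι X j

lemma ι_sigmaPart_of_mem {J : Type v} (X : J → C) {S : Finset J} {j : J} (hj : j ∈ S) :
    Sigma.ι X j ≫ sigmaPart X S = Sigma.ι X j := by
  rw [sigmaPart, Preadditive.comp_sum, Finset.sum_eq_single_of_mem j hj]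
  · simp
  · intro k _ hk
    rw [Sigma.ι_π_of_ne_assoc _ hk.symm, zero_comp]

lemma ι_sigmaPart_of_mem_assoc {J : Type v} (X : J → C) {S : Finset J} {j : J} (hj : j ∈ S)
    {Y : C} (g : ∐ X ⟶ Y) : Sigma.ι X j ≫ sigmaPart X S ≫ g = Sigma.ι X j ≫ g := by
  rw [← Category.assoc, ι_sigmaPart_of_mem X hj]

lemma ι_sigmaPart_of_notMem {J : Type v} (X : J → C) {S : Finset J} {j : J} (hj : j ∉ S) :
    Sigma.ι X j ≫ sigmaPart X S = 0 := by
  rw [sigmaPart, Preadditive.comp_sum]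
  refine Finset.sum_eq_zero fun k hk => ?_
  rw [Sigma.ι_π_of_ne_assoc _ (by rintro rfl; exact hj hk), zero_comp]

lemma ι_sigmaPart_of_notMem_assoc {J : Type v} (X : J → C) {S : Finset J} {j : J}
    (hj : j ∉ S) {Y : C} (g : ∐ X ⟶ Y) : Sigma.ι X j ≫ sigmaPart X S ≫ g = 0 ≫ g := by
  rw [← Category.assoc, ι_sigmaPart_of_notMem X hj]

lemma sigmaPart_comp_sigmaPart {J : Type v} (X : J → C) {S S' : Finset J} (h : S ⊆ S') :
    sigmaPart X S ≫ sigmaPart X S' = sigmaPart X S := by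
  refine Sigma.hom_ext _ _ fun j => ?_
  by_cases hj : j ∈ S
  · rw [ι_sigmaPart_of_mem_assoc _ hj, ι_sigmaPart_of_mem _ hj, ι_sigmaPart_of_mem _ (h hj)]
  · rw [ι_sigmaPart_of_notMem_assoc _ hj, ι_sigmaPart_of_notMem _ hj, zero_comp]

lemma sigmaPart_apply {J : Type v} (G : J → AddCommGrpCat.{v}) (S : Finset J)
    (y : (∐ G : AddCommGrpCat)) :
    sigmaPart G S y = ∑ j ∈ S, Sigma.ι G j (Sigma.π G j y) := by
  rw [sigmaPart]
  induction S using Finset.induction_on with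
  | empty => simp
  | insert j S hj ih =>
    rw [Finset.sum_insert hj, Finset.sum_insert hj, ← ih]
    rfl

lemma exists_sigmaPart_apply_eq {J : Type v} (G : J → AddCommGrpCat.{v})
    (y : (∐ G : AddCommGrpCat)) : ∃ S : Finset J, sigmaPart G S y = y := by
  have hy := (closure_iUnion_range_eq_top _ (coproductIsCoproduct G)).ge (AddSubgroup.mem_top y)
  -- Allowing every larger finite set makes the property stable under sums.
  suffices ∃ S : Finset J, ∀ S', S ⊆ S' → sigmaPart G S' y = y from
    this.imp fun S hS => hS S subset_rfl
  induction hy using AddSubgroup.closure_induction with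
  | mem x hx =>
    obtain ⟨j, y, rfl⟩ := Set.mem_iUnion.1 hx
    refine ⟨{j}, fun S' hS' => ?_⟩
    exact congr($(ι_sigmaPart_of_mem G (hS' (Finset.mem_singleton_self j))) y)
  | zero => exact ⟨∅, fun S' _ => map_zero _⟩
  | add x y _ _ hx hy =>
    obtain ⟨S, hS⟩ := hx
    obtain ⟨T, hT⟩ := hy
    refine ⟨S ∪ T, fun S' hS' => ?_⟩
    rw [map_add, hS _ (Finset.union_subset_left hS'), hT _ (Finset.union_subset_right hS')]
  | neg x _ hx =>
    obtain ⟨S, hS⟩ := hx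
    exact ⟨S, fun S' hS' => by rw [map_neg, hS _ hS']⟩

/-- An object is compact if and only if every morphism to a coproduct factors through a finite
subcoproduct. -/
theorem compact_iff (c : C) : compact C c ↔ ∀ (J : Type v) (X : J → C) (x : c ⟶ ∐ X),
    ∃ S : Finset J, ∀ S', S ⊆ S' → x ≫ sigmaPart X S' = x := by
  constructor
  · intro hc J X x
    have := hc J
    have ht := isColimitCofanMkObjOfIsColimit (preadditiveCoyoneda.obj (Opposite.op c)) _ _
      (coproductIsCoproduct X)
    have hx := (closure_iUnion_range_eq_top _ ht).ge (AddSubgroup.mem_top x)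
    induction hx using AddSubgroup.closure_induction with
    | mem x hx =>
      obtain ⟨j, (y : c ⟶ X j), hy⟩ := Set.mem_iUnion.1 hx
      obtain rfl : y ≫ Sigma.ι X j = x := hy
      refine ⟨{j}, fun S' hS' => ?_⟩
      rw [Category.assoc, ι_sigmaPart_of_mem _ (hS' (Finset.mem_singleton_self j))]
    | zero => exact ⟨∅, fun S' _ => zero_comp⟩
    | add x y _ _ hx hy =>
      classical
      obtain ⟨S, hS⟩ := hx
      obtain ⟨T, hT⟩ := hy
      refine ⟨S ∪ T, fun S' hS' => (Preadditive.add_comp _ _ _ _ _ _).trans ?_⟩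
      rw [hS _ (Finset.union_subset_left hS'), hT _ (Finset.union_subset_right hS')]
      rfl
    | neg x _ hx =>
      obtain ⟨S, hS⟩ := hx
      refine ⟨S, fun S' hS' => (Preadditive.neg_comp _ _).trans ?_⟩
      rw [hS _ hS']
      rfl
  · intro h J
    suffices ∀ X : J → C,
        PreservesColimit (Discrete.functor X) (preadditiveCoyoneda.obj (Opposite.op c)) from
      ⟨fun {K} => preservesColimit_of_iso_diagram _ (Discrete.natIsoFunctor (F := K)).symm⟩
    intro X
    set F := preadditiveCoyoneda.obj (Opposite.op c)
    suffices IsIso (sigmaComparison F X) from PreservesCoproduct.of_iso_comparison _ _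
    rw [ConcreteCategory.isIso_iff_bijective]
    constructor
    · rw [injective_iff_map_eq_zero]
      intro y hy
      obtain ⟨S, hS⟩ := exists_sigmaPart_apply_eq _ y
      rw [← hS, sigmaPart_apply]
      refine Finset.sum_eq_zero fun j _ => ?_
      -- The comparison map is compatible with projections, so an element of its kernel has zero
      -- components.
      have hj : sigmaComparison F X ≫ F.map (Sigma.π X j) = Sigma.π (fun j => F.obj (X j)) j := by
        refine Sigma.hom_ext _ _ fun k => ?_
        rw [ι_comp_sigmaComparison_assoc, ← F.map_comp]
        by_cases hk : k = j
        · subst hk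
          simp
        · rw [Sigma.ι_π_of_ne _ hk, Sigma.ι_π_of_ne _ hk, F.map_zero]
      rw [← hj, ConcreteCategory.comp_apply, hy, map_zero, map_zero]
    · intro x
      obtain ⟨S, hS⟩ := h J X x
      refine ⟨∑ j ∈ S, Sigma.ι (fun j => F.obj (X j)) j (F.map (Sigma.π X j) x), ?_⟩
      rw [map_sum]
      refine Eq.trans (Finset.sum_congr rfl fun j _ => ?_)
        ((Preadditive.comp_sum _ _ _).symm.trans (hS S subset_rfl))
      rw [← ConcreteCategory.comp_apply, ι_comp_sigmaComparison]
      exact Category.assoc _ _ _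

lemma compact.exists_sigmaPart {c : C} (hc : compact C c) {J : Type v} {X : J → C}
    (x : c ⟶ ∐ X) : ∃ S : Finset J, ∀ S', S ⊆ S' → x ≫ sigmaPart X S' = x :=
  (compact_iff c).1 hc J X x

lemma compact.eq_sum {c : C} (hc : compact C c) {J : Type v} {X : J → C} (x : c ⟶ ∐ X) :
    ∃ S : Finset J, x = ∑ j ∈ S, (x ≫ Sigma.π X j) ≫ Sigma.ι X j := by
  obtain ⟨S, hS⟩ := hc.exists_sigmaPart x
  refine ⟨S, (hS S subset_rfl).symm.trans ?_⟩
  rw [sigmaPart, Preadditive.comp_sum]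
  exact Finset.sum_congr rfl fun j _ => (Category.assoc _ _ _).symm

lemma compact.exists_eq_sum {c : C} (hc : compact C c) {J : Type v} {X : J → C} (x : c ⟶ ∐ X) :
    ∃ (S : Finset J) (y : ∀ j, c ⟶ X j), x = ∑ j ∈ S, y j ≫ Sigma.ι X j :=
  (hc.eq_sum x).imp fun _ hS => ⟨_, hS⟩

lemma compact_of_isZero {c : C} (hc : IsZero c) : compact C c := by
  rw [compact_iff]
  exact fun J X x => ⟨∅, fun S' _ => hc.eq_of_src _ _⟩

lemma compact_sigma {J : Type v} [Finite J] {c : J → C} (hc : ∀ j, compact C (c j)) :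
    compact C (∐ c) := by
  have := Fintype.ofFinite J
  rw [compact_iff]
  intro K X x
  choose S hS using fun j => (hc j).exists_sigmaPart (Sigma.ι c j ≫ x)
  refine ⟨Finset.univ.biUnion S, fun S' hS' => Sigma.hom_ext _ _ fun j => ?_⟩
  rw [← Category.assoc]
  exact hS j S' ((Finset.subset_biUnion_of_mem S (Finset.mem_univ j)).trans hS')

/-- Cutting `x` down to the support of its restriction to `T.obj₁` leaves an error that factors
through `T.obj₃`, so it has finite support as well; the union of the two supports works. -/
lemma compact_of_triangle [HasZeroObject C] [HasShift C ℤ]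
    [∀ n : ℤ, (shiftFunctor C n).Additive] [Pretriangulated C] (T : Triangle C)
    (hT : T ∈ distTriang C) (h₁ : compact C T.obj₁) (h₃ : compact C T.obj₃) : compact C T.obj₂ := by
  rw [compact_iff]
  intro J X x
  obtain ⟨S, hS⟩ := h₁.exists_sigmaPart (T.mor₁ ≫ x)
  obtain ⟨y, hy⟩ := T.yoneda_exact₂ hT (x - x ≫ sigmaPart X S) (by
    rw [Preadditive.comp_sub, ← Category.assoc, hS S subset_rfl, sub_self])
  obtain ⟨S₂, hS₂⟩ := h₃.exists_sigmaPart y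
  refine ⟨S ∪ S₂, fun S' hS' => ?_⟩
  have h := congr(T.mor₂ ≫ $(hS₂ S' (Finset.union_subset_right hS')))
  rw [← Category.assoc, ← hy, Preadditive.sub_comp, Category.assoc,
    sigmaPart_comp_sigmaPart _ (Finset.union_subset_left hS')] at h
  exact sub_left_injective h

end Compact

end TriangulatedHeart

namespace TriangulatedHeart

/-! ### The t-structure generated by a shift-stable class of compact objects -/

/-! ### Maps from compact objects into a telescope -/

section Telescope

variable {C : Type u} [Category.{v} C] [Preadditive C] [HasCoproducts.{v} C]

/-- The shift by one endomorphism of the coproduct of a sequence of objects. -/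
noncomputable def telescopeShift {F : ℕ → C} (i : ∀ n, F n ⟶ F (n + 1)) :
    (∐ fun n : ULift.{v} ℕ => F n.down) ⟶ ∐ fun n : ULift.{v} ℕ => F n.down :=
  Sigma.desc fun n => i n.down ≫ Sigma.ι (fun n : ULift.{v} ℕ => F n.down) ⟨n.down + 1⟩

/-- The equation makes the component at 0 vanish and expresses each later component through the
previous one. Compactness is what lets the components determine `x`. -/
lemma compact.eq_zero_of_comp_telescopeShift_eq {c : C} (hc : compact C c) {F : ℕ → C}
    (i : ∀ n, F n ⟶ F (n + 1)) (x : c ⟶ ∐ fun n : ULift.{v} ℕ => F n.down)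
    (hx : x ≫ telescopeShift i = x) : x = 0 := by
  obtain ⟨S, hS⟩ := hc.eq_sum x
  suffices ∀ n, x ≫ Sigma.π _ ⟨n⟩ = 0 by
    rw [hS]
    refine Finset.sum_eq_zero fun j _ => (congrArg (· ≫ _) ?_).trans zero_comp
    convert this j.down
  intro n
  induction n with
  | zero =>
    rw [← hx, Category.assoc]
    have : telescopeShift i ≫ Sigma.π (fun n : ULift.{v} ℕ => F n.down) ⟨0⟩ = 0 :=
      Sigma.hom_ext _ _ fun n => by
        simp only [telescopeShift, colimit.ι_desc_assoc, Discrete.functor_obj_eq_as, Cofan.mk_pt,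
          Cofan.mk_ι_app, Category.assoc, comp_zero]
        rw [Sigma.ι_π_of_ne _ (by simp), comp_zero]
    rw [this, comp_zero]
  | succ n ih =>
    rw [← hx, Category.assoc]
    have : telescopeShift i ≫ Sigma.π (fun n : ULift.{v} ℕ => F n.down) ⟨n + 1⟩ =
        Sigma.π (fun n : ULift.{v} ℕ => F n.down) ⟨n⟩ ≫ i n :=
      Sigma.hom_ext _ _ fun k => by
        simp only [telescopeShift, colimit.ι_desc_assoc, Discrete.functor_obj_eq_as, Cofan.mk_pt,
          Cofan.mk_ι_app, Category.assoc]
        obtain ⟨k⟩ := k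
        by_cases hk : k = n
        · subst hk
          simp
        · rw [Sigma.ι_π_of_ne _ (by simpa using hk), Sigma.ι_π_of_ne_assoc _ (by simpa using hk),
            comp_zero, zero_comp]
    rw [this, ← Category.assoc, ih, zero_comp]

omit [Preadditive C] in
lemma exists_ι_comp_eq_of_telescope {F : ℕ → C} {i : ∀ n, F n ⟶ F (n + 1)} {Y : C}
    {g : (∐ fun n : ULift.{v} ℕ => F n.down) ⟶ Y} (hg : telescopeShift i ≫ g = g) {n m : ℕ}
    (hnm : n ≤ m) : ∃ u : F n ⟶ F m, Sigma.ι (fun n : ULift.{v} ℕ => F n.down) ⟨n⟩ ≫ g =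
      u ≫ Sigma.ι (fun n : ULift.{v} ℕ => F n.down) ⟨m⟩ ≫ g := by
  induction m, hnm using Nat.le_induction with
  | base => exact ⟨𝟙 _, by simp⟩
  | succ m _ ih =>
    obtain ⟨u, hu⟩ := ih
    refine ⟨u ≫ i m, ?_⟩
    rw [hu]
    conv_lhs => rw [← hg]
    simp [telescopeShift]

end Telescope

/-! ### Closure properties of `coprod` and construction of the truncation triangle -/

section Coprod

variable {C : Type u} [Category.{v} C] [HasZeroObject C] [HasShift C ℤ] [Preadditive C]
  [∀ n : ℤ, (shiftFunctor C n).Additive] [Pretriangulated C]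

instance (P : ObjectProperty C) : (coprod P).IsClosedUnderIsomorphisms where
  of_iso {X Y} e h := by
    refine coprod.of_coproduct PUnit (fun _ => X) (Cofan.mk Y fun _ => e.hom)
      (Cofan.IsColimit.mk _ (fun s => e.inv ≫ s.inj ⟨⟩) (by simp) fun s m hm => ?_) fun _ => h
    simp [← hm ⟨⟩]

lemma coprod_of_isZero (P : ObjectProperty C) {X : C} (hX : IsZero X) : coprod P X :=
  coprod.of_coproduct PEmpty (fun j => j.elim) (Cofan.mk X fun j => j.elim)
    (Cofan.IsColimit.mk _ (fun _ => 0) (fun _ j => j.elim) fun _ _ _ => hX.eq_of_src _ _)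
    fun j => j.elim

lemma coprod_sigma [HasCoproducts.{v} C] {P : ObjectProperty C} {J : Type v} {X : J → C}
    (hX : ∀ j, coprod P (X j)) : coprod P (∐ X) :=
  coprod.of_coproduct J X _ (coproductIsCoproduct X) hX

lemma coprod_shift {P : ObjectProperty C} (hP : ∀ X, P X → P (X⟦(1 : ℤ)⟧)) {X : C}
    (hX : coprod P X) : coprod P (X⟦(1 : ℤ)⟧) := by
  induction hX with
  | of_mem X hX => exact .of_mem _ (hP X hX)
  | of_triangle T hT _ _ h₁ h₃ => exact .of_triangle _ (T.shift_distinguished hT 1) h₁ h₃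
  | of_coproduct J X c hc _ h =>
    exact .of_coproduct J (fun j => (X j)⟦(1 : ℤ)⟧) (Cofan.mk _ fun j => (c.inj j)⟦1⟧')
      (isColimitCofanMkObjOfIsColimit (shiftFunctor C (1 : ℤ)) _ _
        (hc.ofIsoColimit (Cofan.ext (Iso.refl _)))) h

lemma coprod_rightOrthogonal_iff {P : ObjectProperty C} (Y : C) :
    (coprod P).rightOrthogonal Y ↔ P.rightOrthogonal Y := by
  refine ⟨fun h X f hX => h f (.of_mem X hX), fun h X f hX => ?_⟩
  induction hX with
  | of_mem X hX => exact h f hX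
  | of_triangle T hT _ _ h₁ h₃ =>
    obtain ⟨g, rfl⟩ := T.yoneda_exact₂ hT f (h₁ _)
    rw [h₃ g, comp_zero]
  | of_coproduct J X c hc _ h =>
    exact Cofan.IsColimit.hom_ext hc _ _ fun j => (h j _).trans comp_zero.symm

variable [HasCoproducts.{v} C]

/-- Composition with `𝟙 - telescopeShift i` is injective on maps from compact objects, so `x ≫ h =
0` and `x` lifts to the coproduct. The lift has finite support, and in `Y` its components can all be
pushed to the largest index. -/
lemma compact.exists_factor_telescope {c : C} (hc : compact C c) {F : ℕ → C}
    {i : ∀ n, F n ⟶ F (n + 1)} {Y : C} {g : (∐ fun n : ULift.{v} ℕ => F n.down) ⟶ Y}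
    {h : Y ⟶ (∐ fun n : ULift.{v} ℕ => F n.down)⟦(1 : ℤ)⟧}
    (hT : Triangle.mk (𝟙 _ - telescopeShift i) g h ∈ distTriang C) (x : c ⟶ Y) :
    ∃ (n : ℕ) (y : c ⟶ F n), x = y ≫ Sigma.ι (fun n : ULift.{v} ℕ => F n.down) ⟨n⟩ ≫ g := by
  have hg : telescopeShift i ≫ g = g := by
    have := mor₁_comp_mor₂ hT
    rwa [Preadditive.sub_comp, Category.id_comp, sub_eq_zero, eq_comm] at this
  have hx : x ≫ h = 0 := by
    obtain ⟨c', hc', e, z, hz⟩ := hc.exists_unshift (x ≫ h)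
    suffices z = 0 by rw [hz, this, Functor.map_zero, comp_zero]
    refine hc'.eq_zero_of_comp_telescopeShift_eq i z ?_
    have : e.hom ≫ (z ≫ (𝟙 _ - telescopeShift i))⟦(1 : ℤ)⟧' = 0 := by
      rw [Functor.map_comp, ← Category.assoc, ← hz, Category.assoc,
        mor₃_comp_shift_mor₁ hT, comp_zero]
    have h0 : z ≫ (𝟙 _ - telescopeShift i) = 0 :=
      (shiftFunctor C (1 : ℤ)).map_injective (by
        rw [← cancel_epi e.hom, this, Functor.map_zero, comp_zero])
    rwa [Preadditive.comp_sub, Category.comp_id, sub_eq_zero, eq_comm] at h0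
  obtain ⟨w, hw⟩ := exists_lift_mor₂ hT x hx
  obtain ⟨S, y, hS⟩ := hc.exists_eq_sum w
  have hN : ∀ n ∈ S, n.down ≤ S.sup ULift.down := fun n hn => Finset.le_sup hn
  set N := S.sup ULift.down
  have hu : ∀ n : ULift.{v} ℕ, n ∈ S → ∃ u : F n.down ⟶ F N,
      Sigma.ι (fun n : ULift.{v} ℕ => F n.down) n ≫ g =
        u ≫ Sigma.ι (fun n : ULift.{v} ℕ => F n.down) ⟨N⟩ ≫ g :=
    fun n hn => exists_ι_comp_eq_of_telescope hg (hN n hn)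
  choose u hu using hu
  refine ⟨N, ∑ n ∈ S.attach, y n.1 ≫ u n.1 n.2, ?_⟩
  rw [← hw, Preadditive.sum_comp]
  conv_lhs => rw [hS]
  rw [Preadditive.sum_comp, ← Finset.sum_attach]
  refine Finset.sum_congr rfl fun n _ => ?_
  rw [Category.assoc _ _ g, Category.assoc _ (u n.1 n.2), hu n.1 n.2]

omit [HasZeroObject C] [HasShift C ℤ] [Preadditive C] [∀ n : ℤ, (shiftFunctor C n).Additive]
  [Pretriangulated C] in
/-- Any set of morphisms from the members of a small family to a given object can be realized by a
single morphism from a coproduct of members. -/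
lemma exists_sigma_cover {J₀ : Type v} (S : J₀ → C) (X : C) (W : ∀ j, (S j ⟶ X) → Prop) :
    ∃ (J : Type v) (p : J → J₀) (f : (∐ fun j => S (p j)) ⟶ X),
      (∀ j, W (p j) (Sigma.ι (fun j => S (p j)) j ≫ f)) ∧
      ∀ j₀ (g : S j₀ ⟶ X), W j₀ g → ∃ h, h ≫ f = g :=
  ⟨Σ j, {g : S j ⟶ X // W j g}, fun j => j.1, Sigma.desc fun j => j.2.1,
    fun j => by simpa using j.2.2, fun j₀ g hg =>
      ⟨Sigma.ι (fun j : Σ j, {g : S j ⟶ X // W j g} => S j.1) ⟨j₀, g, hg⟩, by simp⟩⟩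

/-- One step of the construction: a single δ collects all maps from generators to `Y.left⟦1⟧` that
die in `X⟦1⟧`. The extension classified by δ kills them, and the map to `X` extends because δ dies
there. -/
lemma exists_over_extension {P : ObjectProperty C} {J₀ : Type v} {S : J₀ → C}
    (hS : ∀ j, P (S j)) (hP : ∀ X, P X → ∃ j, Nonempty (X ≅ S j)) {X : C} (Y : Over X) :
    ∃ (Y' : Over X) (i : Y ⟶ Y'), (coprod P Y.left → coprod P Y'.left) ∧
      ∀ a, P a → ∀ g : a ⟶ Y.left⟦(1 : ℤ)⟧, g ≫ Y.hom⟦1⟧' = 0 → g ≫ i.left⟦1⟧' = 0 := by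
  obtain ⟨J, p, δ, hδ, hδ'⟩ :=
    exists_sigma_cover S (Y.left⟦(1 : ℤ)⟧) fun _ g => g ≫ Y.hom⟦1⟧' = 0
  obtain ⟨Z, i, q, hT⟩ := distinguished_cocone_triangle₂ δ
  have h : δ ≫ Y.hom⟦1⟧' = 0 :=
    Sigma.hom_ext _ _ fun j => by rw [← Category.assoc, hδ, comp_zero]
  obtain ⟨f, hf⟩ := exists_desc_mor₁ hT _ h
  refine ⟨Over.mk f, Over.homMk i hf, fun hY => ?_, fun a ha g hg => ?_⟩
  · exact coprod.of_triangle _ hT hY (coprod_sigma fun j => .of_mem _ (hS _))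
  · obtain ⟨j, ⟨e⟩⟩ := hP a ha
    obtain ⟨k, hk⟩ := hδ' j (e.inv ≫ g) (by rw [Category.assoc, hg, comp_zero])
    rw [← cancel_epi e.inv, ← Category.assoc, ← hk, Category.assoc, comp_zero]
    exact (congrArg (k ≫ ·) (mor₃_comp_shift_mor₁ hT)).trans comp_zero

lemma exists_triangle_coprod_rightOrthogonal {P : ObjectProperty C} (hP : P ≤ compact C)
    (hP' : ObjectProperty.EssentiallySmall.{v} P) (hP₁ : ∀ X, P X → P (X⟦(1 : ℤ)⟧)) (X : C) :
    ∃ (Y Z : C) (_ : coprod P Y) (_ : (coprod P).rightOrthogonal Z) (f : Y ⟶ X) (g : X ⟶ Z)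
      (h : Z ⟶ Y⟦(1 : ℤ)⟧), Triangle.mk f g h ∈ distTriang C := by
  obtain ⟨Q, hQ, hQP, hPQ⟩ := ObjectProperty.EssentiallySmall.exists_small_le P
  let S : Shrink.{v} (Subtype Q) → C := fun j => ((equivShrink _).symm j).1
  have hS : ∀ j, P (S j) := fun j => hQP _ ((equivShrink _).symm j).2
  have hS' : ∀ X, P X → ∃ j, Nonempty (X ≅ S j) := fun X hX => by
    obtain ⟨Y, hY, ⟨e⟩⟩ := hPQ _ hX
    exact ⟨equivShrink _ ⟨Y, hY⟩, ⟨e ≪≫ eqToIso (by simp [S])⟩⟩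
  choose next i hco hi using exists_over_extension (X := X) hS hS'
  obtain ⟨J, p, f₀, -, hf₀⟩ := exists_sigma_cover S X fun _ _ => True
  let F : ℕ → Over X := fun n => Nat.rec (Over.mk f₀) (fun _ Y => next Y) n
  have hF : ∀ n, coprod P (F n).left := fun n => by
    induction n with
    | zero => exact coprod_sigma fun j => .of_mem _ (hS _)
    | succ n ih => exact hco _ ih
  let s := telescopeShift (F := fun n => (F n).left) fun n => (i (F n)).left
  obtain ⟨Y, g, h, hT⟩ := distinguished_cocone_triangle (𝟙 _ - s)
  -- The telescope is an extension of the shifted coproduct by the coproduct; stability of P under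
  -- the shift enters here.
  have hY : coprod P Y := by
    have h₁ : coprod P (∐ fun n : ULift.{v} ℕ => (F n.down).left) := coprod_sigma fun n => hF _
    exact coprod.of_triangle _ (rot_of_distTriang _ hT) h₁ (coprod_shift hP₁ h₁)
  have hg : s ≫ g = g := by
    have := mor₁_comp_mor₂ hT
    rwa [Preadditive.sub_comp, Category.id_comp, sub_eq_zero, eq_comm] at this
  obtain ⟨f, hf⟩ := exists_desc_mor₂ hT (Sigma.desc fun n => (F n.down).hom) (by
    rw [Preadditive.sub_comp, sub_eq_zero, Category.id_comp]
    refine Sigma.hom_ext _ _ fun n => ?_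
    simp only [s, telescopeShift, Sigma.ι_desc, Sigma.ι_desc_assoc, Category.assoc]
    exact (Over.w (i (F n.down))).symm)
  have hf' (n : ℕ) : Sigma.ι (fun n : ULift.{v} ℕ => (F n.down).left) ⟨n⟩ ≫ g ≫ f = (F n).hom := by
    rw [hf, Sigma.ι_desc]
  obtain ⟨Z, q, d, hT'⟩ := distinguished_cocone_triangle f
  refine ⟨Y, Z, hY, (coprod_rightOrthogonal_iff Z).2 fun a x ha => ?_, f, q, d, hT'⟩
  -- The map `x ≫ d` to `Y⟦1⟧` comes from a stage `F n` and dies in `X⟦1⟧`, so the next stage kills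
  -- it.
  have hx : x ≫ d = 0 := by
    obtain ⟨c', hc', e, z, hz⟩ := (hP a ha).exists_unshift (x ≫ d)
    obtain ⟨n, y, hy⟩ :=
      hc'.exists_factor_telescope (F := fun n => (F n).left) (i := fun n => (i (F n)).left) hT z
    have hzf : e.hom ≫ (z ≫ f)⟦(1 : ℤ)⟧' = 0 := by
      rw [Functor.map_comp, ← Category.assoc, ← hz, Category.assoc, mor₃_comp_shift_mor₁ hT',
        comp_zero]
    have hzf' : z ≫ f = y ≫ (F n).hom := by rw [hy, Category.assoc, Category.assoc, hf']
    have hk := hi (F n) a ha (e.hom ≫ y⟦1⟧') (by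
      rw [Category.assoc, ← Functor.map_comp, ← hzf', hzf])
    rw [Category.assoc, ← Functor.map_comp] at hk
    have hk' : y ≫ (i (F n)).left = 0 := (shiftFunctor C (1 : ℤ)).map_injective (by
      rw [← cancel_epi e.hom, hk, Functor.map_zero, comp_zero])
    have hι : Sigma.ι (fun n : ULift.{v} ℕ => (F n.down).left) ⟨n⟩ ≫ g =
        (i (F n)).left ≫ Sigma.ι (fun n : ULift.{v} ℕ => (F n.down).left) ⟨n + 1⟩ ≫ g := by
      conv_lhs => rw [← hg]
      simp [s, telescopeShift]
    rw [hz, hy, hι, ← Category.assoc, hk', zero_comp, Functor.map_zero, comp_zero]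
  -- Now `x` comes from a map to `X`; such maps factor through the initial stage `f₀`, hence through
  -- `f`, and vanish in `Z`.
  obtain ⟨w, rfl⟩ := exists_lift_mor₂ hT' x hx
  obtain ⟨j, ⟨e⟩⟩ := hS' a ha
  obtain ⟨k, hk⟩ := hf₀ j (e.inv ≫ w) trivial
  have hf₀' : f₀ ≫ q = 0 := by
    have : f₀ = Sigma.ι (fun n : ULift.{v} ℕ => (F n.down).left) ⟨0⟩ ≫ g ≫ f := (hf' 0).symm
    rw [this, Category.assoc, Category.assoc, mor₁_comp_mor₂ hT', comp_zero, comp_zero]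
  rw [← cancel_epi e.inv, ← Category.assoc, ← hk, Category.assoc, hf₀', comp_zero, comp_zero]

/-- The t-structure `(Coprod(P), Coprod(P)^⊥)` generated by a shift-stable, essentially small class
of compact objects. -/
noncomputable def generatedTStructure (P : ObjectProperty C) (hP : P ≤ compact C)
    (hP' : ObjectProperty.EssentiallySmall.{v} P) (hP₁ : ∀ X, P X → P (X⟦(1 : ℤ)⟧)) :
    TStructure C where
  le n X := coprod P (X⟦n⟧)
  -- The shift by `n - 1` makes `ge 1` the orthogonal itself.
  ge n X := (coprod P).rightOrthogonal (X⟦n - 1⟧)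
  le_isClosedUnderIsomorphisms n :=
    ⟨fun e h => (coprod P).prop_of_iso ((shiftFunctor C n).mapIso e) h⟩
  ge_isClosedUnderIsomorphisms n :=
    ⟨fun e h => (coprod P).rightOrthogonal.prop_of_iso ((shiftFunctor C (n - 1)).mapIso e) h⟩
  le_shift n a n' h X hX := (coprod P).prop_of_iso ((shiftFunctorAdd' C a n' n h).app X) hX
  ge_shift n a n' h X hX := (coprod P).rightOrthogonal.prop_of_iso
    ((shiftFunctorAdd' C a (n' - 1) (n - 1) (by lia)).app X) hX
  zero' X Y f hX hY := by
    have hX' := (coprod P).prop_of_iso ((shiftFunctorZero C ℤ).app X) hX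
    have hY' := (coprod P).rightOrthogonal.prop_of_iso ((shiftFunctorZero C ℤ).app Y) hY
    exact hY' f hX'
  le_zero_le X hX := (coprod P).prop_of_iso
    ((shiftFunctorAdd' C (0 : ℤ) 1 1 (by lia)).symm.app X) (coprod_shift hP₁ hX)
  ge_one_le X hX Y f hY := by
    let e := (shiftFunctorAdd' C (0 - 1 : ℤ) 1 (1 - 1) (by lia)).app X
    have h : f⟦(1 : ℤ)⟧' ≫ e.inv = 0 := hX _ (coprod_shift hP₁ hY)
    refine (shiftFunctor C (1 : ℤ)).map_injective ?_
    rw [← cancel_mono e.inv, h, Functor.map_zero, zero_comp]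
  exists_triangle_zero_one X := by
    obtain ⟨Y, Z, hY, hZ, f, g, h, hT⟩ := exists_triangle_coprod_rightOrthogonal hP hP' hP₁ X
    exact ⟨Y, Z, (coprod P).prop_of_iso ((shiftFunctorZero C ℤ).symm.app Y) hY,
      (coprod P).rightOrthogonal.prop_of_iso ((shiftFunctorZero C ℤ).symm.app Z) hZ, f, g, h, hT⟩

end Coprod

end TriangulatedHeart

namespace TriangulatedHeart

/-! ### Morphisms from compact objects to objects of `coprod P` -/

section Factorization

open ZeroObject

variable {C : Type u} [Category.{v} C] [HasZeroObject C] [HasShift C ℤ] [Preadditive C]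
  [∀ n : ℤ, (shiftFunctor C n).Additive] [Pretriangulated C]

/-- `B` consists of compact objects, contains `P` and the zero objects, and is closed under
extensions. -/
structure IsCompactExtension (P B : ObjectProperty C) : Prop where
  le : P ≤ B
  le_compact : B ≤ compact C
  of_isZero : ∀ ⦃X : C⦄, IsZero X → B X
  of_triangle : ∀ T ∈ distTriang C, B T.obj₁ → B T.obj₃ → B T.obj₂

/-- A morphism factors through an object satisfying `B`. -/
def FactorsThrough (B : ObjectProperty C) {X Y : C} (f : X ⟶ Y) : Prop :=
  ∃ (b : C) (_ : B b) (u : X ⟶ b) (w : b ⟶ Y), f = u ≫ w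

namespace IsCompactExtension

variable {P B : ObjectProperty C} (hB : IsCompactExtension P B)

include hB

lemma factorsThrough_zero (X Y : C) : FactorsThrough B (0 : X ⟶ Y) :=
  ⟨0, hB.of_isZero (isZero_zero C), 0, 0, by simp⟩

lemma factorsThrough_add {X Y : C} {f g : X ⟶ Y} (hf : FactorsThrough B f)
    (hg : FactorsThrough B g) : FactorsThrough B (f + g) := by
  obtain ⟨b, hb, u, w, rfl⟩ := hf
  obtain ⟨b', hb', u', w', rfl⟩ := hg
  exact ⟨b ⊞ b', hB.of_triangle _ (binaryBiproductTriangle_distinguished b b') hb hb',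
    biprod.lift u u', biprod.desc w w', by simp⟩

lemma factorsThrough_sum {X Y : C} {J : Type*} (S : Finset J) {f : J → (X ⟶ Y)}
    (hf : ∀ j ∈ S, FactorsThrough B (f j)) : FactorsThrough B (∑ j ∈ S, f j) :=
  Finset.sum_induction f _ (fun _ _ => hB.factorsThrough_add) (hB.factorsThrough_zero X Y) hf

variable [HasCoproducts.{v} C]

/-- Morphisms from compact objects to objects of `coprod P` factor through `B`. -/
theorem factorsThrough {c X : C} (hc : compact C c) (hX : coprod P X) (x : c ⟶ X) :
    FactorsThrough B x := by
  induction hX generalizing c with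
  | of_mem X hX => exact ⟨X, hB.le _ hX, x, 𝟙 X, by simp⟩
  | of_triangle T hT _ _ h₁ h₃ =>
    -- First factor the image of `x` in `T.obj₃` through `b`. The obstruction to lifting `w` to
    -- `T.obj₂` vanishes on `c`, so it comes from a map `k` on the compact fibre `d` of `u`, to
    -- which the induction hypothesis applies.
    obtain ⟨b, hb, u, w, hw⟩ := h₃ hc (x ≫ T.mor₂)
    obtain ⟨d, j, ε, hd⟩ := distinguished_cocone_triangle₁ u
    have hd' : compact C d :=
      compact_of_triangle _ (inv_rot_of_distTriang _ hd) (compact_shift (hB.le_compact _ hb) _) hc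
    obtain ⟨k', hk'⟩ := exists_desc_mor₃ hd (w ≫ T.mor₃) (by
      rw [← Category.assoc, ← hw, Category.assoc, comp_distTriang_mor_zero₂₃ _ hT, comp_zero])
    obtain ⟨k, rfl⟩ := (shiftFunctor C (1 : ℤ)).map_surjective k'
    obtain ⟨b', hb', u', w', rfl⟩ := h₁ hd' k
    -- The extension `p` of `b` by `b'` is chosen so that `u` lifts to it and the obstruction to
    -- lifting `w` becomes zero on it.
    obtain ⟨p, i, q, hp⟩ := distinguished_cocone_triangle₂ (ε ≫ u'⟦(1 : ℤ)⟧')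
    obtain ⟨s, hs⟩ := exists_lift_mor₂ hp u (by
      rw [← Category.assoc, mor₂_comp_mor₃ hd, zero_comp])
    obtain ⟨t, ht⟩ := T.coyoneda_exact₃ hT (q ≫ w) (by
      rw [Category.assoc, ← hk', Functor.map_comp, ← Category.assoc ε,
        mor₂_comp_mor₃_assoc hp, zero_comp])
    -- The error `x - s ≫ t` comes from `T.obj₁`, so the induction hypothesis factors it too.
    obtain ⟨r, hr⟩ := T.coyoneda_exact₂ hT (x - s ≫ t) (by
      rw [Preadditive.sub_comp, hw, Category.assoc, ← ht, ← Category.assoc, hs, sub_self])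
    obtain ⟨b₂, hb₂, u₂, w₂, rfl⟩ := h₁ hc r
    rw [← sub_add_cancel x (s ≫ t), hr]
    exact hB.factorsThrough_add ⟨b₂, hb₂, u₂, w₂ ≫ T.mor₁, by simp⟩
      ⟨p, hB.of_triangle _ hp hb' hb, s, t, rfl⟩
  | of_coproduct J X t ht _ h =>
    let e := (coproductIsCoproduct X).coconePointUniqueUpToIso ht
    obtain ⟨S, y, hS⟩ := hc.exists_eq_sum (x ≫ e.inv)
    have : x = ∑ j ∈ S, y j ≫ Sigma.ι X j ≫ e.hom := by
      rw [← cancel_mono e.inv, Preadditive.sum_comp]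
      conv_lhs => rw [hS]
      simp
    rw [this]
    refine hB.factorsThrough_sum S fun j _ => ?_
    obtain ⟨b, hb, u, w, hw⟩ := h j hc (y j)
    exact ⟨b, hb, u, w ≫ Sigma.ι X j ≫ e.hom, by rw [hw, Category.assoc]⟩

lemma exists_factor_shift {c X : C} (hc : compact C c) (hX : coprod P X) (x : c ⟶ X⟦(1 : ℤ)⟧) :
    ∃ (b : C) (_ : B b) (δ : c ⟶ b⟦(1 : ℤ)⟧) (y : b ⟶ X), x = δ ≫ y⟦(1 : ℤ)⟧' := by
  obtain ⟨c', hc', e, z, rfl⟩ := hc.exists_unshift x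
  obtain ⟨b, hb, u, w, rfl⟩ := hB.factorsThrough hc' hX z
  exact ⟨b, hb, e.hom ≫ u⟦1⟧', w, by simp⟩

/-- Morphisms from objects of `coprod P` to an object with no nonzero morphism from shifted objects
of `coprod P` are detected by `B`. -/
theorem eq_zero_of_forall_comp_eq_zero {X Y : C} (hX : coprod P X)
    (hY : ∀ b, B b → ∀ f : b⟦(1 : ℤ)⟧ ⟶ Y, f = 0) (f : X ⟶ Y)
    (hf : ∀ b, B b → ∀ u : b ⟶ X, u ≫ f = 0) : f = 0 := by
  induction hX with
  | of_mem X hX => simpa using hf X (hB.le _ hX) (𝟙 X)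
  | of_triangle T hT h₁' _ h₁ h₃ =>
    obtain ⟨g, rfl⟩ := T.yoneda_exact₂ hT f
      (h₁ _ fun b hb u => by rw [← Category.assoc]; exact hf b hb _)
    suffices g = 0 by rw [this, comp_zero]
    refine h₃ g fun b hb u => ?_
    -- The map `u` need not lift to `T.obj₂`, but it does after pulling back to an extension `p` of
    -- `b` by `b'`. There the composite to `Y` vanishes, so `u ≫ g` factors through `b'⟦1⟧`, which
    -- has no nonzero map to `Y`.
    obtain ⟨b', hb', δ, y, hy⟩ := hB.exists_factor_shift (hB.le_compact _ hb) h₁' (u ≫ T.mor₃)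
    obtain ⟨p, i, q, hp⟩ := distinguished_cocone_triangle₂ δ
    obtain ⟨t, ht⟩ := T.coyoneda_exact₃ hT (q ≫ u) (by
      rw [Category.assoc, hy, mor₂_comp_mor₃_assoc hp, zero_comp])
    obtain ⟨k, hk⟩ := exists_desc_mor₃ hp (u ≫ g) (by
      rw [← Category.assoc, ht, Category.assoc]
      exact hf p (hB.of_triangle _ hp hb' hb) t)
    rw [← hk, hY b' hb' k, comp_zero]
  | of_coproduct J X t ht _ h =>
    refine Cofan.IsColimit.hom_ext ht _ _ fun j => ?_
    rw [comp_zero]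
    exact h j _ fun b hb u => by rw [← Category.assoc]; exact hf b hb _

end IsCompactExtension

/-- An extension is determined up to isomorphism by its connecting map, and between representatives
these form a small set. -/
lemma essentiallySmall_extensionProduct (P : ObjectProperty C)
    [ObjectProperty.EssentiallySmall.{v} P] :
    ObjectProperty.EssentiallySmall.{v} (P.extensionProduct P) := by
  obtain ⟨Q, hQ, hPQ⟩ := ObjectProperty.EssentiallySmall.exists_small_le'.{v} P
  choose E i q hE using fun (x : Σ (Y Z : Subtype Q), (Z.1 ⟶ Y.1⟦(1 : ℤ)⟧)) =>
    distinguished_cocone_triangle₂ x.2.2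
  refine ⟨ObjectProperty.ofObj E, inferInstance, ?_⟩
  refine (ObjectProperty.monotone_extensionProduct_left _ hPQ).trans
    ((ObjectProperty.monotone_extensionProduct_right _ hPQ).trans ?_)
  rw [ObjectProperty.extensionProduct_isoClosure_left,
    ObjectProperty.extensionProduct_isoClosure_right]
  rintro X ⟨Y, Z, f, g, h, hT, hY, hZ⟩
  let x : Σ (Y Z : Subtype Q), (Z.1 ⟶ Y.1⟦(1 : ℤ)⟧) := ⟨⟨Y, hY⟩, ⟨Z, hZ⟩, h⟩
  have hx : h ≫ (𝟙 Y)⟦(1 : ℤ)⟧' = 𝟙 Z ≫ h := by simp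
  obtain ⟨b, h₁, h₂⟩ :=
    complete_distinguished_triangle_morphism₂ _ _ hT (hE x) (𝟙 Y) (𝟙 Z) hx
  let φ : Triangle.mk f g h ⟶ Triangle.mk (i x) (q x) x.2.2 :=
    { hom₁ := 𝟙 Y, hom₂ := b, hom₃ := 𝟙 Z, comm₁ := h₁, comm₂ := h₂, comm₃ := hx }
  have : IsIso φ.hom₂ := isIso₂_of_isIso₁₃ φ hT (hE x) (inferInstanceAs (IsIso (𝟙 Y)))
    (inferInstanceAs (IsIso (𝟙 Z)))
  exact ⟨E x, ⟨x⟩, ⟨@asIso C _ X (E x) φ.hom₂ this⟩⟩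

/-- The iterated extensions of objects satisfying `P` and zero objects. -/
def iteratedExtensions (P : ObjectProperty C) : ℕ → ObjectProperty C
  | 0 => P ⊔ ObjectProperty.ofObj fun _ : PUnit.{1} => (0 : C)
  | n + 1 => (iteratedExtensions P n).extensionProduct (iteratedExtensions P n)

lemma essentiallySmall_iteratedExtensions (P : ObjectProperty C)
    [ObjectProperty.EssentiallySmall.{v} P] (n : ℕ) :
    ObjectProperty.EssentiallySmall.{v} (iteratedExtensions P n) := by
  induction n with
  | zero =>
    rw [iteratedExtensions]
    infer_instance
  | succ n ih => exact essentiallySmall_extensionProduct _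

/-- Each level contains a zero object, so every object is an extension of members of its own level.
-/
lemma monotone_iteratedExtensions (P : ObjectProperty C) : Monotone (iteratedExtensions P) := by
  have h (n : ℕ) : (iteratedExtensions P n).ContainsZero ∧
      iteratedExtensions P n ≤ iteratedExtensions P (n + 1) := by
    suffices (iteratedExtensions P n).ContainsZero from
      ⟨this, ObjectProperty.le_extensionProduct_left _⟩
    induction n with
    | zero => exact ⟨0, isZero_zero C, Or.inr ⟨⟨⟩⟩⟩
    | succ n ih =>
      obtain ⟨Z, hZ, hZ'⟩ := ih.exists_zero
      exact ⟨Z, hZ, ObjectProperty.le_extensionProduct_left _ _ hZ'⟩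
  exact monotone_nat_of_le_succ fun n => (h n).2

/-- A class of compact objects is contained in an essentially small class of compact objects of
`coprod P` which is closed under extensions. -/
theorem exists_isCompactExtension [HasCoproducts.{v} C] {P : ObjectProperty C}
    (hP : P ≤ compact C) [ObjectProperty.EssentiallySmall.{v} P] :
    ∃ (B : ObjectProperty C) (_ : ObjectProperty.EssentiallySmall.{v} B),
      IsCompactExtension P B ∧ B ≤ coprod P := by
  have h (n : ℕ) := essentiallySmall_iteratedExtensions P n
  have hsup (X : C) : (⨆ n : ℕ, iteratedExtensions P n) X ↔ ∃ n, iteratedExtensions P n X := by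
    simp
  have hmem {Q : ObjectProperty C} (h₁ : P ≤ Q) (h₂ : ∀ X, IsZero X → Q X)
      (h₃ : ∀ T ∈ distTriang C, Q T.obj₁ → Q T.obj₃ → Q T.obj₂) :
      (⨆ n : ℕ, iteratedExtensions P n) ≤ Q := by
    refine iSup_le fun n => ?_
    induction n with
    | zero =>
      rintro X (hX | ⟨⟨⟩⟩)
      · exact h₁ _ hX
      · exact h₂ _ (isZero_zero C)
    | succ n ih =>
      rintro X ⟨Y, Z, f, g, h, hT, hY, hZ⟩
      exact h₃ _ hT (ih _ hY) (ih _ hZ)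
  refine ⟨⨆ n : ℕ, iteratedExtensions P n, inferInstance, ⟨?_, ?_, ?_, ?_⟩, ?_⟩
  · exact fun X hX => (hsup X).2 ⟨0, Or.inl hX⟩
  · exact hmem hP (fun X hX => compact_of_isZero hX) compact_of_triangle
  · intro X hX
    have : (iteratedExtensions P 1).IsClosedUnderIsomorphisms :=
      inferInstanceAs ((iteratedExtensions P 0).extensionProduct _).IsClosedUnderIsomorphisms
    exact (hsup X).2 ⟨1, ObjectProperty.prop_of_iso _ ((isZero_zero C).iso hX)
      (monotone_iteratedExtensions P zero_le_one _ (Or.inr ⟨⟨⟩⟩))⟩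
  · intro T hT h₁ h₃
    obtain ⟨n, hn⟩ := (hsup _).1 h₁
    obtain ⟨m, hm⟩ := (hsup _).1 h₃
    exact (hsup _).2 ⟨max n m + 1, T.obj₁, T.obj₃, T.mor₁, T.mor₂, T.mor₃, hT,
      monotone_iteratedExtensions P (le_max_left n m) _ hn,
      monotone_iteratedExtensions P (le_max_right n m) _ hm⟩
  · exact hmem (fun X hX => .of_mem X hX) (fun X hX => coprod_of_isZero P hX)
      fun T hT h₁ h₃ => .of_triangle T hT h₁ h₃

end Factorization

end TriangulatedHeart

namespace TriangulatedHeart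

/-! ### Truncations and colimits in the heart -/

section Truncation

variable {C : Type u} [Category.{v} C] [HasZeroObject C] [HasShift C ℤ] [Preadditive C]
  [∀ n : ℤ, (shiftFunctor C n).Additive] [Pretriangulated C] (t : TStructure C)

/-- A morphism `η : c ⟶ X` exhibits `X` as the truncation of `c` in degrees `≥ 0`. -/
structure IsTruncation {c X : C} (η : c ⟶ X) : Prop where
  isGE : t.IsGE X 0
  exists_triangle : ∃ (L : C) (_ : t.IsLE L (-1)) (i : L ⟶ c) (d : X ⟶ L⟦(1 : ℤ)⟧),
    Triangle.mk i η d ∈ distTriang C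

lemma isTruncation_truncGEπ (c : C) : IsTruncation t ((t.truncGEπ 0).app c) where
  isGE := inferInstanceAs (t.IsGE ((t.truncGE 0).obj c) 0)
  exists_triangle :=
    ⟨_, t.isLE_truncLT_obj c 0 (-1), _, _, t.triangleLTGE_distinguished 0 c⟩

namespace IsTruncation

variable {t} {c X : C} {η : c ⟶ X} (hη : IsTruncation t η)

include hη

/-- The difference factors through `L⟦1⟧`, which is ≤ -2. -/
lemma hom_ext {Y : C} (hY : t.IsGE Y 0) {f g : X ⟶ Y} (h : η ≫ f = η ≫ g) : f = g := by
  obtain ⟨L, hL, i, d, hT⟩ := hη.exists_triangle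
  obtain ⟨k, hk⟩ := exists_desc_mor₃ hT (f - g) (by rw [Preadditive.comp_sub, h, sub_self])
  have := t.isLE_shift L (-1) 1 (-2)
  rw [← sub_eq_zero, ← hk, t.zero k (-2) 0, comp_zero]

lemma exists_desc {Y : C} (hY : t.IsGE Y 0) (f : c ⟶ Y) : ∃ g : X ⟶ Y, η ≫ g = f := by
  obtain ⟨L, hL, i, d, hT⟩ := hη.exists_triangle
  exact exists_desc_mor₂ hT f (t.zero _ (-1) 0)

lemma isLE (hc : t.IsLE c 0) : t.IsLE X 0 := by
  obtain ⟨L, hL, i, d, hT⟩ := hη.exists_triangle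
  have := t.isLE_shift L (-1) 1 (-2)
  exact t.isLE₂ _ (rot_of_distTriang _ hT) 0 hc (t.isLE_of_le (L⟦(1 : ℤ)⟧) (-2) 0)

lemma precomp_iso {c' : C} (e : c' ≅ c) : IsTruncation t (e.hom ≫ η) where
  isGE := hη.isGE
  exists_triangle := by
    obtain ⟨L, hL, i, d, hT⟩ := hη.exists_triangle
    have h₁ : (i ≫ e.inv) ≫ e.hom = 𝟙 L ≫ i := by simp
    have h₂ : (e.hom ≫ η) ≫ 𝟙 X = e.hom ≫ η := by simp
    have h₃ : d ≫ (𝟙 L)⟦(1 : ℤ)⟧' = 𝟙 X ≫ d := by simp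
    exact ⟨L, hL, i ≫ e.inv, d, isomorphic_distinguished _ hT _
      (Triangle.isoMk _ _ (Iso.refl L) e (Iso.refl X) h₁ h₂ h₃)⟩

/-- Two truncations of the same object are isomorphic. -/
lemma nonempty_iso {X' : C} {η' : c ⟶ X'} (hη' : IsTruncation t η') :
    ∃ e : X ≅ X', η ≫ e.hom = η' := by
  obtain ⟨f, hf⟩ := hη.exists_desc hη'.isGE η'
  obtain ⟨g, hg⟩ := hη'.exists_desc hη.isGE η
  refine ⟨⟨f, g, hη.hom_ext hη.isGE ?_, hη'.hom_ext hη'.isGE ?_⟩, hf⟩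
  · rw [← Category.assoc, hf, hg, Category.comp_id]
  · rw [← Category.assoc, hg, hf, Category.comp_id]

lemma postcomp_iso {X' : C} (e : X ≅ X') : IsTruncation t (η ≫ e.hom) where
  isGE := have := hη.isGE; t.isGE_of_iso e 0
  exists_triangle := by
    obtain ⟨L, hL, i, d, hT⟩ := hη.exists_triangle
    have h₁ : i ≫ 𝟙 c = 𝟙 L ≫ i := by simp
    have h₂ : (η ≫ e.hom) ≫ e.inv = 𝟙 c ≫ η := by simp
    have h₃ : (e.inv ≫ d) ≫ (𝟙 L)⟦(1 : ℤ)⟧' = e.inv ≫ d := by simp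
    exact ⟨L, hL, i, e.inv ≫ d, isomorphic_distinguished _ hT _
      (Triangle.isoMk _ _ (Iso.refl L) (Iso.refl c) e.symm h₁ h₂ h₃)⟩

end IsTruncation

lemma isLE_sigma [HasCoproducts.{v} C] {J : Type v} {X : J → C} {n : ℤ}
    (hX : ∀ j, t.IsLE (X j) n) : t.IsLE (∐ X) n := by
  rw [t.isLE_iff_orthogonal n (n + 1) rfl]
  intro Y f _
  exact Sigma.hom_ext _ _ fun j => by rw [t.zero (Sigma.ι X j ≫ f) n (n + 1), comp_zero]

/-- The cone of a morphism between objects `≤ 0` admits few morphisms to objects `≥ 0`. -/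
lemma hom_ext_of_triangle {D E W Y : C} {r : D ⟶ E} {e : E ⟶ W} {δ : W ⟶ D⟦(1 : ℤ)⟧}
    (hT : Triangle.mk r e δ ∈ distTriang C) (hD : t.IsLE D 0) (hY : t.IsGE Y 0)
    {f g : W ⟶ Y} (h : e ≫ f = e ≫ g) : f = g := by
  obtain ⟨k, hk⟩ := exists_desc_mor₃ hT (f - g) (by rw [Preadditive.comp_sub, h, sub_self])
  have := t.isLE_shift D 0 1 (-1)
  rw [← sub_eq_zero, ← hk, t.zero k (-1) 0, comp_zero]

lemma Heart.isLE {t : TStructure C} (X : Heart t) : t.IsLE X.obj 0 :=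
  ((t.mem_heart_iff _).1 X.property).1

lemma Heart.isGE {t : TStructure C} (X : Heart t) : t.IsGE X.obj 0 :=
  ((t.mem_heart_iff _).1 X.property).2

variable [IsTriangulated C]

lemma isTruncation_cohomologyZero {c : C} (hc : t.IsLE c 0) :
    ∃ η : c ⟶ ((cohomologyZero t).obj c).obj, IsTruncation t η := by
  have : IsIso ((t.truncLEι 0).app c) := (t.isLE_iff_isIso_truncLEι_app 0 c).1 hc
  exact ⟨_, (isTruncation_truncGEπ t _).precomp_iso (asIso ((t.truncLEι 0).app c)).symm⟩

/-- The images under `H⁰` of a class of objects `≤ 0`. -/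
lemma map_cohomologyZero_iff (P : ObjectProperty C) (X : Heart t) :
    (P ⊓ t.le 0).map (cohomologyZero t) X ↔
      ∃ (c : C) (_ : P c) (_ : t.IsLE c 0) (η : c ⟶ X.obj), IsTruncation t η := by
  constructor
  · rintro ⟨c, ⟨hc, hc'⟩, ⟨e⟩⟩
    obtain ⟨η, hη⟩ := isTruncation_cohomologyZero t ⟨hc'⟩
    exact ⟨c, hc, ⟨hc'⟩, _, hη.postcomp_iso (t.heart.ι.mapIso e)⟩
  · rintro ⟨c, hc, hc', η, hη⟩
    obtain ⟨η', hη'⟩ := isTruncation_cohomologyZero t hc'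
    obtain ⟨e, -⟩ := hη'.nonempty_iso hη
    exact ⟨c, ⟨hc, hc'.le⟩, ⟨t.heart.isoMk e⟩⟩

end Truncation

/-! ### Colimits in the heart and its abelian structure -/

section Colimits

variable {C : Type u} [Category.{v} C] [HasZeroObject C] [HasShift C ℤ] [Preadditive C]
  [∀ n : ℤ, (shiftFunctor C n).Additive] [Pretriangulated C]
  [HasCoproducts.{v} C] {t : TStructure C} {J : Type v} [SmallCategory J] (K : J ⥤ Heart t)

/-- The coproduct in the triangulated category of the values of a diagram in the heart. -/
noncomputable abbrev sigmaObj : C := ∐ fun j => (K.obj j).obj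

/-- The coproduct in the triangulated category of the sources of the arrows of a diagram in the
heart. -/
noncomputable abbrev sigmaArrow : C := ∐ fun a : Σ i j : J, (i ⟶ j) => (K.obj a.1).obj

/-- The inclusion of a value of the diagram. -/
noncomputable abbrev sigmaObjι (j : J) : (K.obj j).obj ⟶ sigmaObj K :=
  Sigma.ι (fun j => (K.obj j).obj) j

/-- The inclusion of the source of an arrow of the diagram. -/
noncomputable abbrev sigmaArrowι {i j : J} (f : i ⟶ j) : (K.obj i).obj ⟶ sigmaArrow K :=
  Sigma.ι (fun a : Σ i j : J, (i ⟶ j) => (K.obj a.1).obj) ⟨i, j, f⟩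

/-- The relations defining the colimit of a diagram in the heart. -/
noncomputable def relations : sigmaArrow K ⟶ sigmaObj K :=
  Sigma.desc fun a => sigmaObjι K a.1 - (K.map a.2.2).hom ≫ sigmaObjι K a.2.1

lemma ι_relations {i j : J} (f : i ⟶ j) :
    sigmaArrowι K f ≫ relations K = sigmaObjι K i - (K.map f).hom ≫ sigmaObjι K j :=
  Sigma.ι_desc _ _

lemma ι_relations_assoc {i j : J} (f : i ⟶ j) {Y : C} (g : sigmaObj K ⟶ Y) :
    sigmaArrowι K f ≫ relations K ≫ g =
      (sigmaObjι K i - (K.map f).hom ≫ sigmaObjι K j) ≫ g := by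
  rw [← Category.assoc, ι_relations]

variable {K} {W Z : C} {e : sigmaObj K ⟶ W} {δ : W ⟶ (sigmaArrow K)⟦(1 : ℤ)⟧} {π : W ⟶ Z}

lemma isLE_sigmaArrow : t.IsLE (sigmaArrow K) 0 := isLE_sigma t fun a => (K.obj a.1).isLE

lemma isLE_cone_relations (hT : Triangle.mk (relations K) e δ ∈ distTriang C) : t.IsLE W 0 := by
  have h : t.IsLE (sigmaArrow K) 0 := isLE_sigmaArrow
  have := t.isLE_shift (sigmaArrow K) 0 1 (-1)
  exact t.isLE₂ _ (rot_of_distTriang _ hT) 0 (isLE_sigma t fun j => (K.obj j).isLE)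
    (t.isLE_of_le ((sigmaArrow K)⟦(1 : ℤ)⟧) (-1) 0)

/-- The cocone in the heart given by the truncation of the cone of `relations K`. -/
noncomputable def heartCocone (hT : Triangle.mk (relations K) e δ ∈ distTriang C)
    (hπ : IsTruncation t π) : Cocone K where
  pt := ⟨Z, (t.mem_heart_iff _).2 ⟨hπ.isLE (isLE_cone_relations hT), hπ.isGE⟩⟩
  ι :=
    { app j := ObjectProperty.homMk (sigmaObjι K j ≫ e ≫ π)
      naturality i j f := by
        have h := sigmaArrowι K f ≫= mor₁_comp_mor₂_assoc hT π
        rw [ι_relations_assoc, zero_comp, comp_zero, Preadditive.sub_comp, sub_eq_zero] at h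
        have h' : (K.map f).hom ≫ sigmaObjι K j ≫ e ≫ π = (sigmaObjι K i ≫ e ≫ π) ≫ 𝟙 Z := by
          simpa using h.symm
        exact ObjectProperty.hom_ext _ h' }

/-- The truncation of the cone of `relations K` is the colimit of `K` in the heart. -/
noncomputable def isColimitHeartCocone (hT : Triangle.mk (relations K) e δ ∈ distTriang C)
    (hπ : IsTruncation t π) : IsColimit (heartCocone hT hπ) := by
  have h (s : Cocone K) : ∃ g : Z ⟶ s.pt.obj, ∀ j, sigmaObjι K j ≫ e ≫ π ≫ g = (s.ι.app j).hom := by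
    let φ : sigmaObj K ⟶ s.pt.obj := Sigma.desc fun j => (s.ι.app j).hom
    have hφ (k : J) : sigmaObjι K k ≫ φ = (s.ι.app k).hom := Sigma.ι_desc _ _
    obtain ⟨g, hg⟩ := exists_desc_mor₂ hT φ (Sigma.hom_ext _ _ fun ⟨i, j, f⟩ => by
        have hs : (K.map f).hom ≫ (s.ι.app j).hom = (s.ι.app i).hom := congr($(s.w f).hom)
        refine (ι_relations_assoc K f φ).trans ?_
        rw [Preadditive.sub_comp, Category.assoc, hφ, hφ, hs, sub_self, comp_zero])
    obtain ⟨g', rfl⟩ := hπ.exists_desc s.pt.isGE g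
    exact ⟨g', fun j => (congrArg _ hg).trans (hφ j)⟩
  choose desc hdesc using h
  refine ⟨fun s => ObjectProperty.homMk (desc s), fun s j => ?_, fun s m hm => ?_⟩
  · have h : (sigmaObjι K j ≫ e ≫ π) ≫ desc s = (s.ι.app j).hom := by simpa using hdesc s j
    exact ObjectProperty.hom_ext _ h
  -- Uniqueness survives both passages, to the cone and to its truncation: the shifted object of
  -- relations is ≤ -1 and the target is ≥ 0.
  · refine ObjectProperty.hom_ext _ (hπ.hom_ext s.pt.isGE (hom_ext_of_triangle t hT isLE_sigmaArrow
      s.pt.isGE (Sigma.hom_ext _ _ fun j => ?_)))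
    let m' : Z ⟶ s.pt.obj := m.hom
    have h : (sigmaObjι K j ≫ e ≫ π) ≫ m' = (s.ι.app j).hom := congr($(hm j).hom)
    refine Eq.trans ?_ (hdesc s j).symm
    simpa using h

variable (K) in
/-- Every diagram in the heart has a colimit of the form `heartCocone`. -/
lemma exists_isTruncation_cone_relations :
    ∃ (W Z : C) (e : sigmaObj K ⟶ W) (δ : W ⟶ (sigmaArrow K)⟦(1 : ℤ)⟧) (π : W ⟶ Z),
      Triangle.mk (relations K) e δ ∈ distTriang C ∧ IsTruncation t π := by
  obtain ⟨W, e, δ, hT⟩ := distinguished_cocone_triangle (relations K)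
  exact ⟨W, _, e, δ, _, hT, isTruncation_truncGEπ t W⟩

instance : HasColimitsOfSize.{v, v} (Heart t) where
  has_colimits_of_shape J _ :=
    { has_colimit K := by
        obtain ⟨W, Z, e, δ, π, hT, hπ⟩ := exists_isTruncation_cone_relations K
        exact ⟨_, isColimitHeartCocone hT hπ⟩ }

instance : HasFiniteProducts (Heart t) :=
  have : HasFiniteCoproducts (Heart t) := inferInstance
  have : HasFiniteBiproducts (Heart t) := HasFiniteBiproducts.of_hasFiniteCoproducts
  inferInstance

/-- The heart of a t-structure is an abelian category. -/
noncomputable abbrev heartAbelian [IsTriangulated C] (t : TStructure C) : Abelian (Heart t) :=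
  AbelianSubcategory.abelian t.heart.ι
    (fun X Y n f hn => by
      have := X.isLE
      have := Y.isGE
      have := t.isGE_shift Y.obj 0 n (-n)
      exact t.zero (X := X.obj) (Y := Y.obj⟦n⟧) f 0 (-n))
    (by
      ext X₁ X₂ f₁
      simp only [MorphismProperty.top_apply, iff_true]
      intro X₃ f₂ f₃ hT
      have := X₁.isLE
      have := X₂.isLE
      have := X₁.isGE
      have := X₂.isGE
      have := t.isLE_shift X₁.obj 0 1 (-1)
      have := t.isGE_shift X₁.obj 0 1 (-1)
      -- The cone lies in degrees -1 and 0. In its truncation triangle, `L⟦-1⟧` and the truncation ≥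
      -- 0 lie in the heart; they play the roles of kernel and cokernel.
      have hLE : t.IsLE X₃ 0 := t.isLE₂ _ (rot_of_distTriang _ hT) 0 X₂.isLE
        (t.isLE_of_le (X₁.obj⟦(1 : ℤ)⟧) (-1) 0)
      have hGE : t.IsGE X₃ (-1) := t.isGE₂ _ (rot_of_distTriang _ hT) (-1)
        (t.isGE_of_ge X₂.obj (-1) 0) this
      have hπ := isTruncation_truncGEπ t X₃
      obtain ⟨L, hL, i, d, hT'⟩ := hπ.exists_triangle
      have hQ := hπ.isGE
      have := t.isGE_shift ((t.truncGE 0).obj X₃) 0 (-1) 1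
      have hL' : t.IsGE L (-1) := t.isGE₂ _ (inv_rot_of_distTriang _ hT') (-1)
        (t.isGE_of_ge (((t.truncGE 0).obj X₃)⟦(-1 : ℤ)⟧) (-1) 1) hGE
      let e : L⟦(-1 : ℤ)⟧⟦(1 : ℤ)⟧ ≅ L := (shiftEquiv C (1 : ℤ)).counitIso.app L
      have hK : t.heart (L⟦(-1 : ℤ)⟧) :=
        (t.mem_heart_iff _).2 ⟨t.isLE_shift L (-1) (-1) 0, t.isGE_shift L (-1) (-1) 0⟩
      have h₁ : (e.hom ≫ i) ≫ 𝟙 X₃ = e.hom ≫ i := by simp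
      have h₂ : (t.truncGEπ 0).app X₃ ≫ 𝟙 _ = 𝟙 _ ≫ (t.truncGEπ 0).app X₃ := by simp
      have h₃ : (d ≫ e.inv⟦(1 : ℤ)⟧') ≫ e.hom⟦(1 : ℤ)⟧' = 𝟙 _ ≫ d := by
        rw [Category.assoc, ← Functor.map_comp, e.inv_hom_id]
        simp
      exact ⟨⟨_, hK⟩, ⟨_, (t.mem_heart_iff _).2 ⟨hπ.isLE hLE, hQ⟩⟩, e.hom ≫ i, _, d ≫ e.inv⟦1⟧',
        isomorphic_distinguished _ hT' _
          (Triangle.isoMk _ _ e (Iso.refl X₃) (Iso.refl _) h₁ h₂ h₃)⟩)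

end Colimits

end TriangulatedHeart

namespace TriangulatedHeart

/-! ### Compact objects and filtered colimits in the heart -/

section Filtered

variable {C : Type u} [Category.{v} C] [HasZeroObject C] [HasShift C ℤ] [Preadditive C]
  [∀ n : ℤ, (shiftFunctor C n).Additive] [Pretriangulated C]

/-- Every morphism from a compact object to an object `≤ 0` factors through a compact object
`≤ 0`. -/
def FactorsCompactly (t : TStructure C) : Prop :=
  ∀ ⦃c X : C⦄ (x : c ⟶ X), compact C c → t.IsLE X 0 →
    ∃ (M : C) (_ : compact C M) (_ : t.IsLE M 0) (u : c ⟶ M) (y : M ⟶ X), u ≫ y = x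

namespace FactorsCompactly

variable {t : TStructure C} (ht : FactorsCompactly t)

include ht

lemma exists_factor {c X : C} (x : c ⟶ X) (hc : compact C c) {n : ℤ} (hX : t.IsLE X n) :
    ∃ (M : C) (_ : compact C M) (_ : t.IsLE M n) (u : c ⟶ M) (y : M ⟶ X), u ≫ y = x := by
  obtain ⟨M, hM, hM', u, y, h⟩ := ht (x⟦n⟧') (compact_shift hc n) (t.isLE_shift X n n 0)
  let e (Y : C) : Y⟦n⟧⟦-n⟧ ≅ Y := (shiftEquiv C n).unitIso.symm.app Y
  have he : (e c).inv ≫ x⟦n⟧'⟦-n⟧' ≫ (e X).hom = x := by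
    have h := (shiftEquiv C n).unitIso.hom.naturality x
    have h' : (e c).inv ≫ x⟦n⟧'⟦-n⟧' = x ≫ (e X).inv := h.symm
    rw [← Category.assoc, h', Category.assoc, Iso.inv_hom_id, Category.comp_id]
  refine ⟨M⟦-n⟧, compact_shift hM _, t.isLE_shift M 0 (-n) n, (e c).inv ≫ u⟦-n⟧',
    y⟦-n⟧' ≫ (e X).hom, ?_⟩
  rw [← he, ← h, Functor.map_comp]
  simp only [Category.assoc]

lemma exists_factor_shift {c X : C} (x : c ⟶ X⟦(1 : ℤ)⟧) (hc : compact C c) {n : ℤ}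
    (hX : t.IsLE X n) : ∃ (M : C) (_ : compact C M) (_ : t.IsLE M n) (δ : c ⟶ M⟦(1 : ℤ)⟧)
      (y : M ⟶ X), δ ≫ y⟦(1 : ℤ)⟧' = x := by
  obtain ⟨c', hc', e, z, rfl⟩ := hc.exists_unshift x
  obtain ⟨M, hM, hM', u, y, rfl⟩ := ht.exists_factor z hc' hX
  exact ⟨M, hM, hM', e.hom ≫ u⟦1⟧', y, by simp⟩

variable [HasCoproducts.{v} C]

/-- A morphism from a compact object to the base of a triangle lifts after passing to the total
object of an extension by a compact object. -/
lemma exists_extension_lift {X Y Z : C} {f : X ⟶ Y} {g : Y ⟶ Z} {h : Z ⟶ X⟦(1 : ℤ)⟧}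
    (hT : Triangle.mk f g h ∈ distTriang C) {n : ℤ} (hX : t.IsLE X n) {c : C} (hc : compact C c)
    (x : c ⟶ Z) : ∃ (M p : C) (_ : compact C M) (_ : t.IsLE M n) (_ : compact C p) (i : M ⟶ p)
      (q : p ⟶ c) (δ : c ⟶ M⟦(1 : ℤ)⟧) (_ : Triangle.mk i q δ ∈ distTriang C) (y : M ⟶ X)
      (_ : δ ≫ y⟦(1 : ℤ)⟧' = x ≫ h) (x' : p ⟶ Y), x' ≫ g = q ≫ x := by
  obtain ⟨M, hM, hM', δ, y, hy⟩ := ht.exists_factor_shift (x ≫ h) hc hX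
  obtain ⟨p, i, q, hp⟩ := distinguished_cocone_triangle₂ δ
  obtain ⟨x', hx'⟩ := exists_lift_mor₂ hT (q ≫ x) (by
    rw [Category.assoc, ← hy, mor₂_comp_mor₃_assoc hp, zero_comp])
  exact ⟨M, p, hM, hM', compact_of_triangle _ hp hM hc, i, q, δ, hp, y, hy, x', hx'⟩

end FactorsCompactly

variable [HasCoproducts.{v} C] {t : TStructure C} {J : Type v} [SmallCategory J] [IsFiltered J]
  {K : J ⥤ Heart t}

/-- Only finitely many components occur, and modulo relations each can be moved along the diagram to
a common index. -/
lemma compact.exists_eq_add_relations {c : C} (hc : compact C c) (x : c ⟶ sigmaObj K) :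
    ∃ (j : J) (x' : c ⟶ (K.obj j).obj) (y : c ⟶ sigmaArrow K),
      x = x' ≫ sigmaObjι K j + y ≫ relations K := by
  obtain ⟨S, y, hy⟩ := hc.exists_eq_sum x
  obtain ⟨j, hj⟩ := IsFiltered.sup_objs_exists S
  let f (k : S) : k.1 ⟶ j := (hj k.2).some
  refine ⟨j, ∑ k ∈ S.attach, y k ≫ (K.map (f k)).hom,
    ∑ k ∈ S.attach, y k ≫ sigmaArrowι K (f k), ?_⟩
  rw [hy, Preadditive.sum_comp, Preadditive.sum_comp, ← Finset.sum_add_distrib,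
    ← Finset.sum_attach]
  refine Finset.sum_congr rfl fun k _ => ?_
  rw [Category.assoc, Category.assoc, ι_relations, Preadditive.comp_sub, add_sub_cancel]

/-- Only finitely many arrows occur in `y`. Filteredness gives an index where all their relations
hold. -/
lemma compact.exists_comp_map_eq_zero {c : C} (hc : compact C c) {i : J}
    (x : c ⟶ (K.obj i).obj) (y : c ⟶ sigmaArrow K)
    (h : x ≫ sigmaObjι K i = y ≫ relations K) :
    ∃ (j : J) (f : i ⟶ j), x ≫ (K.map f).hom = 0 := by
  classical
  obtain ⟨S, z, hz⟩ := hc.exists_eq_sum y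
  let O : Finset J := insert i (S.image (fun a => a.1) ∪ S.image (fun a => a.2.1))
  have hi : i ∈ O := Finset.mem_insert_self _ _
  have h₁ (a : S) : a.1.1 ∈ O := Finset.mem_insert_of_mem
    (Finset.mem_union_left _ (Finset.mem_image_of_mem (fun a => a.1) a.2))
  have h₂ (a : S) : a.1.2.1 ∈ O := Finset.mem_insert_of_mem
    (Finset.mem_union_right _ (Finset.mem_image_of_mem (fun a => a.2.1) a.2))
  let H : Finset (Σ' (X Y : J) (_ : X ∈ O) (_ : Y ∈ O), X ⟶ Y) :=
    S.attach.image fun a => ⟨a.1.1, a.1.2.1, h₁ a, h₂ a, a.1.2.2⟩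
  obtain ⟨j, T, hT⟩ := IsFiltered.sup_exists O H
  -- Outside `O` the value 0 is harmless: the relations involved only use objects of `O`.
  let φ : sigmaObj K ⟶ (K.obj j).obj :=
    Sigma.desc fun k => if hk : k ∈ O then (K.map (T hk)).hom else 0
  have hφ {k : J} (hk : k ∈ O) : sigmaObjι K k ≫ φ = (K.map (T hk)).hom :=
    (Sigma.ι_desc _ _).trans (dif_pos hk)
  have hr (a : S) : sigmaArrowι K a.1.2.2 ≫ relations K ≫ φ = 0 := by
    have hT' := hT (h₁ a) (h₂ a) (Finset.mem_image_of_mem _ (Finset.mem_attach S a))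
    have : (K.map (T (h₁ a))).hom = (K.map a.1.2.2).hom ≫ (K.map (T (h₂ a))).hom := by
      rw [← hT', K.map_comp]
      rfl
    rw [ι_relations_assoc, Preadditive.sub_comp, Category.assoc, hφ (h₁ a), hφ (h₂ a), this,
      sub_self]
  refine ⟨j, T hi, ?_⟩
  rw [← hφ hi, ← Category.assoc, h, hz, Category.assoc, Preadditive.sum_comp]
  refine Finset.sum_eq_zero fun a ha => ?_
  rw [Category.assoc]
  exact (congrArg _ (hr ⟨a, ha⟩)).trans comp_zero

variable {W Z : C} {e : sigmaObj K ⟶ W} {δ : W ⟶ (sigmaArrow K)⟦(1 : ℤ)⟧} {π : W ⟶ Z}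

/-- Injectivity for filtered colimits. The image of `x` in the cone factors through a compact `M` ≤
-1. On the fibre of `c ⟶ M` it is zero, so there `x` dies at a later index; then `x` at that index
factors through `M` and vanishes by orthogonality. -/
lemma FactorsCompactly.exists_comp_map_eq_zero (ht : FactorsCompactly t)
    (hT : Triangle.mk (relations K) e δ ∈ distTriang C) (hπ : IsTruncation t π) {c : C}
    (hc : compact C c) {i : J} (x : c ⟶ (K.obj i).obj) (hx : x ≫ sigmaObjι K i ≫ e ≫ π = 0) :
    ∃ (j : J) (f : i ⟶ j), x ≫ (K.map f).hom = 0 := by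
  obtain ⟨L, hL, l, d, hT'⟩ := hπ.exists_triangle
  obtain ⟨w, hw⟩ := exists_lift_mor₁ hT' (x ≫ sigmaObjι K i ≫ e) (by simpa using hx)
  obtain ⟨M, hM, hM', u, z, rfl⟩ := ht.exists_factor w hc hL
  obtain ⟨p, q, i', hp⟩ := distinguished_cocone_triangle₁ u
  have hpc : compact C p :=
    compact_of_triangle _ (inv_rot_of_distTriang _ hp) (compact_shift hM _) hc
  obtain ⟨y, hy⟩ := exists_lift_mor₁ hT (q ≫ x ≫ sigmaObjι K i) (by
    rw [Category.assoc, Category.assoc, ← hw, Category.assoc, mor₁_comp_mor₂_assoc hp, zero_comp])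
  obtain ⟨j, f, hf⟩ := hpc.exists_comp_map_eq_zero (q ≫ x) y (by rw [hy, Category.assoc])
  obtain ⟨k, hk⟩ := exists_desc_mor₂ hp (x ≫ (K.map f).hom) (by rw [← hf, Category.assoc])
  have := (K.obj j).isGE
  exact ⟨j, f, by rw [← hk, t.zero k (-1) 0, comp_zero]⟩

/-- Surjectivity for filtered colimits. Two extensions by compact objects permit lifting `x`, first
to the cone and then to the coproduct. The lift is pushed to one index, then descended through both
extensions. -/
lemma FactorsCompactly.exists_comp_eq (ht : FactorsCompactly t)
    (hT : Triangle.mk (relations K) e δ ∈ distTriang C) (hπ : IsTruncation t π) {c : C}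
    (hc : compact C c) (x : c ⟶ Z) :
    ∃ (j : J) (x' : c ⟶ (K.obj j).obj), x' ≫ sigmaObjι K j ≫ e ≫ π = x := by
  obtain ⟨L, hL, l, d, hT'⟩ := hπ.exists_triangle
  obtain ⟨M, p, hM, hM', hpc, i, q, γ, hp, -, -, x₁, hx₁⟩ := ht.exists_extension_lift hT' hL hc x
  obtain ⟨M₂, p₂, hM₂, hM₂', hpc₂, i₂, q₂, γ₂, hp₂, y, hy, x₂, hx₂⟩ :=
    ht.exists_extension_lift hT isLE_sigmaArrow hpc x₁
  obtain ⟨y', hy'⟩ := exists_lift_mor₁ hT (i₂ ≫ x₂) (by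
    rw [Category.assoc, hx₂, mor₁_comp_mor₂_assoc hp₂, zero_comp])
  obtain ⟨j, x₃, z, hz⟩ := hpc₂.exists_eq_add_relations x₂
  -- On `M₂` the lift is a combination of relations, so its representative at index `j` dies there
  -- at a later index and descends to `p`. The second descent, to `c`, only needs `M` ≤ -1.
  obtain ⟨k, f, hf⟩ := hM₂.exists_comp_map_eq_zero (i₂ ≫ x₃) (y' - i₂ ≫ z) (by
    rw [Preadditive.sub_comp, hy', hz, Preadditive.comp_add]
    simp)
  obtain ⟨x₄, hx₄⟩ := exists_desc_mor₂ hp₂ (x₃ ≫ (K.map f).hom) (by rw [← hf, Category.assoc])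
  have := (K.obj k).isGE
  obtain ⟨x₅, hx₅⟩ := exists_desc_mor₂ hp x₄ (t.zero _ (-1) 0)
  have hκ : (K.map f).hom ≫ sigmaObjι K k ≫ e = sigmaObjι K j ≫ e := by
    have h := ι_relations_assoc K f e
    rw [mor₁_comp_mor₂ hT, comp_zero, Preadditive.sub_comp, eq_comm, sub_eq_zero] at h
    rw [h, Category.assoc]
  refine ⟨k, x₅, ?_⟩
  have hM₁ : t.IsLE M 0 := t.isLE_of_le M (-1) 0
  refine hom_ext_of_triangle t hp hM₁ hπ.isGE (hom_ext_of_triangle t hp₂ hM₂' hπ.isGE ?_)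
  calc q₂ ≫ q ≫ x₅ ≫ sigmaObjι K k ≫ e ≫ π
      = (q₂ ≫ q ≫ x₅) ≫ sigmaObjι K k ≫ e ≫ π := by simp only [Category.assoc]
    _ = x₃ ≫ ((K.map f).hom ≫ sigmaObjι K k ≫ e) ≫ π := by
      rw [hx₅, hx₄]
      simp only [Category.assoc]
    _ = x₂ ≫ e ≫ π := by
      rw [hκ, hz, Preadditive.add_comp, Category.assoc, Category.assoc, Category.assoc,
        mor₁_comp_mor₂_assoc hT, zero_comp, comp_zero, add_zero]
    _ = q₂ ≫ q ≫ x := by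
      rw [← Category.assoc, hx₂, Category.assoc, hx₁]

open Opposite in
/-- The truncations of compact objects are finitely presentable. -/
theorem FactorsCompactly.isFinitelyPresentable (ht : FactorsCompactly t) {c : C}
    (hc : compact C c) {Y : Heart t} {η : c ⟶ Y.obj} (hη : IsTruncation t η) :
    IsFinitelyPresentable.{v} Y := by
  rw [isFinitelyPresentable_iff_preservesFilteredColimits]
  refine ⟨fun J _ _ => ⟨fun {K} => ?_⟩⟩
  obtain ⟨W, Z, e, δ, π, hT, hπ⟩ := exists_isTruncation_cone_relations K
  refine preservesColimit_of_preserves_colimit_cocone (isColimitHeartCocone hT hπ)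
    (Types.FilteredColimit.isColimitOf' _ _ ?_ ?_)
  · intro (x : Y ⟶ (heartCocone hT hπ).pt)
    obtain ⟨j, x', hx'⟩ := ht.exists_comp_eq hT hπ hc (η ≫ x.hom)
    obtain ⟨y, rfl⟩ := hη.exists_desc (K.obj j).isGE x'
    refine ⟨j, ObjectProperty.homMk y, ObjectProperty.hom_ext _ ?_⟩
    exact hη.hom_ext hπ.isGE (hx'.symm.trans (Category.assoc _ _ _))
  · intro i (x : Y ⟶ K.obj i) (y : Y ⟶ K.obj i) h
    have h' : x.hom ≫ sigmaObjι K i ≫ e ≫ π = y.hom ≫ sigmaObjι K i ≫ e ≫ π :=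
      congr($(h).hom)
    obtain ⟨j, f, hf⟩ := ht.exists_comp_map_eq_zero hT hπ hc (η ≫ (x.hom - y.hom)) (by
      rw [Category.assoc, Preadditive.sub_comp, h', sub_self, comp_zero])
    refine ⟨j, f, ObjectProperty.hom_ext _ (hη.hom_ext (K.obj j).isGE ?_)⟩
    rw [Category.assoc, Preadditive.sub_comp, Preadditive.comp_sub, sub_eq_zero] at hf
    exact hf

end Filtered

end TriangulatedHeart

namespace TriangulatedHeart

/-! ### Finite colimits, generators and exactness of filtered colimits -/

section General

/-- A class of objects which is closed under finite coproducts and cokernels is closed under finite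
colimits. -/
lemma isClosedUnderColimitsOfShape_of_finite {A : Type u} [Category.{v} A] [Preadditive A]
    [HasFiniteCoproducts A] [HasCokernels A] (Q : ObjectProperty A)
    [Q.IsClosedUnderIsomorphisms] [Q.IsClosedUnderFiniteCoproducts] [Q.IsClosedUnderCokernels]
    (J : Type v) [SmallCategory J] [Finite (Arrow J)] :
    Q.IsClosedUnderColimitsOfShape J where
  colimitsOfShape_le := by
    rintro X ⟨p⟩
    have : Finite J := Finite.of_injective (fun j => Arrow.mk (𝟙 j)) fun i j h =>
      congr($(h).left)
    have : Finite (Σ p : J × J, p.1 ⟶ p.2) := Finite.of_injective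
      (fun f => Arrow.mk f.2) (by
        rintro ⟨⟨i, j⟩, f⟩ ⟨⟨i', j'⟩, f'⟩ h
        obtain rfl : i = i' := congr($(h).left)
        obtain rfl : j = j' := congr($(h).right)
        obtain rfl : f = f' := (Arrow.mk_inj _ _).1 h
        rfl)
    let s : (∐ fun f : Σ p : J × J, p.1 ⟶ p.2 => p.diag.obj f.1.1) ⟶ ∐ p.diag.obj :=
      Sigma.desc fun f => p.diag.map f.2 ≫ Sigma.ι p.diag.obj f.1.2
    let t : (∐ fun f : Σ p : J × J, p.1 ⟶ p.2 => p.diag.obj f.1.1) ⟶ ∐ p.diag.obj :=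
      Sigma.desc fun f => Sigma.ι p.diag.obj f.1.1
    have h := HasColimitOfHasCoproductsOfHasCoequalizers.buildIsColimit s t
      (fun f => Sigma.ι_desc _ _) (fun f => Sigma.ι_desc _ _) (colimit.isColimit _)
      (colimit.isColimit _)
      (Preadditive.isColimitCoforkOfCokernelCofork (cokernelIsCokernel (s - t)))
    have hst : Q (cokernel (s - t)) := Q.prop_cokernel (s - t)
      (Q.prop_coproduct fun _ => p.prop_diag_obj _) (Q.prop_coproduct fun _ => p.prop_diag_obj _)
    exact Q.prop_of_iso (h.coconePointUniqueUpToIso p.isColimit) hst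

variable {A : Type u} [Category.{v} A]

/-- In a balanced category, separating classes of objects are strong generators. -/
lemma isStrongGenerator_of_isSeparating [Balanced A] {P : ObjectProperty A}
    (hP : P.IsSeparating) : P.IsStrongGenerator := by
  rw [ObjectProperty.isStrongGenerator_iff]
  refine ⟨hP, fun X Y i _ hi => ?_⟩
  have : Epi i := ⟨fun f g h => hP _ _ fun G hG x => by
    obtain ⟨y, rfl⟩ := hi G hG x
    simp [h]⟩
  exact isIso_of_mono_of_epi i

lemma hasSeparator_of_isSeparating [HasZeroMorphisms A] [HasCoproducts.{v} A]
    {P : ObjectProperty A} [ObjectProperty.Small.{v} P] (hP : P.IsSeparating) :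
    HasSeparator A := by
  let S (i : Shrink.{v} (Subtype P)) : A := ((equivShrink _).symm i).1
  have hS : (ObjectProperty.ofObj S).IsSeparating := by
    refine fun X Y f g h => hP f g fun G hG x => h G ?_ x
    have : S (equivShrink _ ⟨G, hG⟩) = G := by simp [S]
    exact this ▸ ⟨_⟩
  exact ⟨_, isSeparator_sigma S |>.2 hS⟩

/-- Filtered colimits are exact in a category with a strong generator consisting of finitely
presented objects. -/
lemma hasExactColimitsOfShape_of_isStrongGenerator [HasFiniteLimits A] {P : ObjectProperty A}
    (hP : P.IsStrongGenerator) (hP' : P ≤ ObjectProperty.isFinitelyPresentable.{v} A)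
    (J : Type v) [SmallCategory J] [IsFiltered J] [HasColimitsOfShape J A] :
    HasExactColimitsOfShape J A := by
  -- Restricted Yoneda reflects isomorphisms and preserves finite limits and filtered colimits, so
  -- exactness is inherited from types.
  let F : A ⥤ P.FullSubcategoryᵒᵖ ⥤ Type v :=
    yoneda ⋙ (Functor.whiskeringLeft _ _ _).obj P.ι.op
  have : F.ReflectsIsomorphisms := ⟨fun {X Y} f hf => by
    have h (G : A) (hG : P G) : Function.Bijective fun x : G ⟶ X => x ≫ f :=
      (isIso_iff_bijective ((F.map f).app (Opposite.op ⟨G, hG⟩))).1 inferInstance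
    have : Mono f := ⟨fun g g' hg => hP.isSeparating _ _ fun G hG x =>
      (h G hG).1 (by simp [hg])⟩
    exact hP.isIso_of_mono f fun G hG => (h G hG).2⟩
  have : PreservesFiniteLimits F := inferInstance
  have : ReflectsFiniteLimits F := inferInstance
  have : PreservesColimitsOfShape J F :=
    preservesColimitsOfShape_of_evaluation F J fun G =>
      have := isFinitelyPresentable_iff_preservesFilteredColimits.1 (hP' _ G.unop.property)
      inferInstanceAs (PreservesColimitsOfShape J (coyoneda.obj (Opposite.op G.unop.obj)))
  have : HasExactColimitsOfShape J (Type v) := ⟨inferInstance⟩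
  exact HasExactColimitsOfShape.domain_of_functor J F

end General

/-! ### Closure of the truncated compact objects under finite coproducts and cokernels -/

section Heart

variable {C : Type u} [Category.{v} C] [HasZeroObject C] [HasShift C ℤ] [Preadditive C]
  [∀ n : ℤ, (shiftFunctor C n).Additive] [Pretriangulated C] [HasCoproducts.{v} C]
  [IsTriangulated C] {t : TStructure C}

/-- The truncation of a finite coproduct of compact objects is the coproduct in the heart of their
truncations, by the universal property of truncation. -/
instance : ((compact C ⊓ t.le 0).map (cohomologyZero t)).IsClosedUnderFiniteCoproducts := by
  refine .of_isClosedUnderColimitsOfShape.{v} fun J _ => ⟨?_⟩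
  rintro X ⟨p⟩
  have h (j : J) := (map_cohomologyZero_iff t _ _).1 (p.prop_diag_obj ⟨j⟩)
  choose c hc hc' η hη using h
  have hπ := isTruncation_truncGEπ t (∐ c)
  have hLE : t.IsLE (∐ c) 0 := isLE_sigma t hc'
  set π := (t.truncGEπ 0).app (∐ c)
  let Z : Heart t := ⟨(t.truncGE 0).obj (∐ c), (t.mem_heart_iff _).2 ⟨hπ.isLE hLE, hπ.isGE⟩⟩
  choose f hf using fun j => (hη j).exists_desc hπ.isGE (Sigma.ι c j ≫ π)
  let s : Cocone p.diag :=
    { pt := Z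
      ι := Discrete.natTrans fun j => ObjectProperty.homMk (f j.as) }
  have hs (s' : Cocone p.diag) :
      ∃ g : Z.obj ⟶ s'.pt.obj, ∀ j, f j ≫ g = (s'.ι.app ⟨j⟩).hom := by
    obtain ⟨g, hg⟩ := hπ.exists_desc s'.pt.isGE (Sigma.desc fun j => η j ≫ (s'.ι.app ⟨j⟩).hom)
    refine ⟨g, fun j => (hη j).hom_ext s'.pt.isGE ?_⟩
    rw [← Category.assoc, hf, Category.assoc, hg, Sigma.ι_desc]
  choose desc hdesc using hs
  have hs : IsColimit s :=
    { desc s' := ObjectProperty.homMk (desc s')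
      fac s' j := ObjectProperty.hom_ext _ (hdesc s' j.as)
      uniq s' m hm := by
        refine ObjectProperty.hom_ext _ (hπ.hom_ext s'.pt.isGE (Sigma.hom_ext _ _ fun j => ?_))
        have h : f j ≫ m.hom = (s'.ι.app ⟨j⟩).hom := congr($(hm ⟨j⟩).hom)
        have h' : f j ≫ m.hom = f j ≫ desc s' := h.trans (hdesc s' j).symm
        rw [← Category.assoc, ← hf, Category.assoc]
        refine (congrArg _ h').trans ?_
        rw [← Category.assoc, hf, Category.assoc]
        rfl }
  exact ObjectProperty.prop_of_iso _ (hs.coconePointUniqueUpToIso p.isColimit)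
    ((map_cohomologyZero_iff t _ Z).2 ⟨_, compact_sigma hc, hLE, π, hπ⟩)

/-- The truncations of compact objects `≤ 0` are closed under cokernels. -/
lemma FactorsCompactly.isClosedUnderCokernels (ht : FactorsCompactly t) :
    ((compact C ⊓ t.le 0).map (cohomologyZero t)).IsClosedUnderCokernels where
  cokernels_le := by
    rintro _ ⟨f, k, hk, hf⟩
    obtain ⟨c₁, hc₁, hc₁', η₁, hη₁⟩ := (map_cohomologyZero_iff t _ _).1 hf.1
    obtain ⟨c₂, hc₂, hc₂', η₂, hη₂⟩ := (map_cohomologyZero_iff t _ _).1 hf.2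
    obtain ⟨L, hL, l, d, hT⟩ := hη₂.exists_triangle
    -- The morphism need not lift to `c₁ ⟶ c₂`, but it lifts to `p ⟶ c₂` for an extension `p` of
    -- `c₁` by `M` ≤ -1. Maps from `c₁` to objects ≥ 0 are still detected on `p`, so truncating the
    -- cone of `f'` gives the cokernel.
    obtain ⟨M, p, hM, hM', hp, i, q, δ, hT', -, -, f', hf'⟩ :=
      ht.exists_extension_lift hT hL hc₁ (η₁ ≫ f.hom)
    have hM₀ : t.IsLE M 0 := t.isLE_of_le M (-1) 0
    have hp' : t.IsLE p 0 := t.isLE₂ _ hT' 0 hM₀ hc₁'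
    obtain ⟨D, a, b, hD⟩ := distinguished_cocone_triangle f'
    have := t.isLE_shift p 0 1 (-1)
    have hD' : t.IsLE D 0 := t.isLE₂ _ (rot_of_distTriang _ hD) 0 hc₂'
      (t.isLE_of_le (p⟦(1 : ℤ)⟧) (-1) 0)
    have hDc : compact C D :=
      compact_of_triangle _ (rot_of_distTriang _ hD) hc₂ (compact_shift hp 1)
    have hπ := isTruncation_truncGEπ t D
    set π := (t.truncGEπ 0).app D
    let Z : Heart t := ⟨(t.truncGE 0).obj D, (t.mem_heart_iff _).2 ⟨hπ.isLE hD', hπ.isGE⟩⟩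
    obtain ⟨g, hg⟩ := hη₂.exists_desc hπ.isGE (a ≫ π)
    have hfg : f ≫ (ObjectProperty.homMk g : _ ⟶ Z) = 0 := by
      refine ObjectProperty.hom_ext _ (hη₁.hom_ext hπ.isGE
        (hom_ext_of_triangle t hT' hM₀ hπ.isGE ?_))
      calc q ≫ η₁ ≫ f.hom ≫ g = (q ≫ η₁ ≫ f.hom) ≫ g := by simp only [Category.assoc]
        _ = 0 := by rw [← hf', Category.assoc, hg, mor₁_comp_mor₂_assoc hD, zero_comp]
        _ = q ≫ η₁ ≫ 0 := by simp
    have hs {Y : Heart t} (y : _ ⟶ Y) (hy : f ≫ y = 0) : ∃ z : Z ⟶ Y, g ≫ z.hom = y.hom := by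
      have hy' : f.hom ≫ y.hom = 0 := congr($(hy).hom)
      obtain ⟨z, hz⟩ := exists_desc_mor₂ hD (η₂ ≫ y.hom) (by
        rw [← Category.assoc, hf', Category.assoc, Category.assoc, hy', comp_zero, comp_zero])
      obtain ⟨z', rfl⟩ := hπ.exists_desc (Heart.isGE Y) z
      refine ⟨ObjectProperty.homMk z', hη₂.hom_ext (Heart.isGE Y) ?_⟩
      exact (Category.assoc _ _ _).symm.trans
        ((congrArg (· ≫ z') hg).trans ((Category.assoc _ _ _).trans hz))
    have : Epi (ObjectProperty.homMk g : _ ⟶ Z) := ⟨fun {Y} y z h => by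
      refine ObjectProperty.hom_ext _ (hπ.hom_ext (Heart.isGE Y)
        (hom_ext_of_triangle t hD hp' (Heart.isGE Y) ?_))
      have h' : g ≫ y.hom = g ≫ z.hom := congr($(h).hom)
      rw [← Category.assoc, ← hg, Category.assoc]
      refine (congrArg _ h').trans ?_
      rw [← Category.assoc, hg, Category.assoc]⟩
    choose z hz using @hs
    have hZ : IsColimit (CokernelCofork.ofπ (ObjectProperty.homMk g : _ ⟶ Z) hfg) :=
      CokernelCofork.IsColimit.ofπ' _ _ fun y hy =>
        ⟨z y hy, ObjectProperty.hom_ext _ (hz y hy)⟩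
    exact ObjectProperty.prop_of_iso _ (hZ.coconePointUniqueUpToIso hk)
      ((map_cohomologyZero_iff t _ Z).2 ⟨D, hDc, hD', π, hπ⟩)

end Heart

end TriangulatedHeart

namespace TriangulatedHeart

/-! ### The heart of the t-structure generated by compact objects -/

section Generated

variable {C : Type u} [Category.{v} C] [HasZeroObject C] [HasShift C ℤ] [Preadditive C]
  [∀ n : ℤ, (shiftFunctor C n).Additive] [Pretriangulated C] [HasCoproducts.{v} C]
  {t : TStructure C} {P B : ObjectProperty C}

lemma IsCompactExtension.factorsCompactly (hB : IsCompactExtension P B) (hB' : B ≤ coprod P)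
    (ht : t.le 0 = coprod P) : FactorsCompactly t := by
  intro c X x hc hX
  obtain ⟨b, hb, u, w, rfl⟩ := hB.factorsThrough hc (ht.le _ hX.le) x
  exact ⟨b, hB.le_compact _ hb, ⟨ht.ge _ (hB' _ hb)⟩, u, w, rfl⟩

variable [IsTriangulated C]

/-- Maps out of objects ≤ 0 into the heart are detected on `B`, and a map from an object of `B` to
the heart factors through its truncation. Passing to representatives `S` allows the separating class
to be small. -/
lemma IsCompactExtension.isSeparating (hB : IsCompactExtension P B) (hB' : B ≤ coprod P)
    (ht : t.le 0 = coprod P) {S : ObjectProperty C} (hS : B ≤ S.isoClosure) :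
    (S.strictMap (cohomologyZero t)).IsSeparating := by
  intro X Y f g h
  refine ObjectProperty.hom_ext _ (sub_eq_zero.1
    (hB.eq_zero_of_forall_comp_eq_zero (ht.le _ X.isLE.le) (fun b hb x => ?_) _ fun b hb x => ?_))
  · have : t.IsLE b 0 := ⟨ht.ge _ (hB' _ hb)⟩
    have := t.isLE_shift b 0 1 (-1)
    have := Y.isGE
    exact t.zero x (-1) 0
  · obtain ⟨s, hs, ⟨e⟩⟩ := hS b hb
    have : t.IsLE b 0 := ⟨ht.ge _ (hB' _ hb)⟩
    obtain ⟨η, hη⟩ := isTruncation_cohomologyZero t (t.isLE_of_iso e 0)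
    obtain ⟨y, hy⟩ := hη.exists_desc X.isGE (e.inv ≫ x)
    have hfg := h _ ⟨s, hs⟩ (ObjectProperty.homMk y)
    have hfg' : y ≫ f.hom = y ≫ g.hom := congr($(hfg).hom)
    rw [← cancel_epi e.inv, ← Category.assoc, ← hy, Category.assoc, Preadditive.comp_sub, hfg',
      sub_self, comp_zero, comp_zero]

attribute [local instance] Cardinal.fact_isRegular_aleph0

/-- If the objects `≤ 0` of a t-structure are those of `Coprod(P)` for an essentially small class
`P` of compact objects, the heart is locally finitely presented and Grothendieck abelian, and its
finitely presented objects are the truncations of compact objects. -/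
theorem heart_of_le_eq_coprod (hP : P ≤ compact C) [ObjectProperty.EssentiallySmall.{v} P]
    (ht : t.le 0 = coprod P) :
    (∃ ab : Abelian (Heart t),
      ab.toPreadditive = (inferInstance : Preadditive (Heart t)) ∧
        IsGrothendieckAbelian.{v} (Heart t)) ∧
      IsLocallyFinitelyPresentable.{v} (Heart t) ∧
      ObjectProperty.isFinitelyPresentable.{v} (Heart t) =
        (compact C ⊓ t.le 0).map (cohomologyZero t) := by
  obtain ⟨B, hBs, hB, hB'⟩ := exists_isCompactExtension hP
  obtain ⟨S, hS, hSB, hBS⟩ := ObjectProperty.EssentiallySmall.exists_small_le.{v} B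
  have hF := hB.factorsCompactly hB' ht
  let ab := heartAbelian t
  have hG := hB.isSeparating hB' ht hBS
  have hG' := isStrongGenerator_of_isSeparating hG
  have hSQ : S.strictMap (cohomologyZero t) ≤ (compact C ⊓ t.le 0).map (cohomologyZero t) := by
    rintro _ ⟨_, hs⟩
    exact ObjectProperty.prop_map_obj _ _ ⟨hB.le_compact _ (hSB _ hs), ht.ge _ (hB' _ (hSB _ hs))⟩
  have hQ : (compact C ⊓ t.le 0).map (cohomologyZero t) ≤
      ObjectProperty.isFinitelyPresentable.{v} (Heart t) := by
    intro X hX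
    obtain ⟨c, hc, -, η, hη⟩ := (map_cohomologyZero_iff t _ _).1 hX
    exact hF.isFinitelyPresentable hc hη
  refine ⟨⟨ab, rfl, ?_⟩, ?_, le_antisymm ?_ hQ⟩
  · have h (J : Type v) [SmallCategory J] [IsFiltered J] :=
      hasExactColimitsOfShape_of_isStrongGenerator hG' (hSQ.trans hQ) J
    exact
      { ab5OfSize := ⟨fun J _ _ => h J⟩
        hasSeparator := hasSeparator_of_isSeparating hG }
  · exact (IsCardinalLocallyPresentable.iff_exists_isStrongGenerator _ _).2
      ⟨_, inferInstance, hG', hSQ.trans hQ⟩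
  -- Finitely presented objects form the closure of the generators under finite colimits, so closure
  -- under finite coproducts and cokernels is enough.
  · refine (IsStrongGenerator.colimitsCardinalClosure_eq_isCardinalPresentable
      (κ := Cardinal.aleph0.{v}) hG' (hSQ.trans hQ)).le.trans ?_
    have := hF.isClosedUnderCokernels
    refine ObjectProperty.colimitsCardinalClosure_le _ _ (fun J _ hJ => ?_) hSQ
    have : Finite (Arrow J) := (hasCardinalLT_aleph0_iff _).1 hJ
    exact isClosedUnderColimitsOfShape_of_finite _ J

end Generated

end TriangulatedHeart
theorem mainTheorem2 {T : Type u} [Category.{v} T] [HasZeroObject T] [HasShift T ℤ]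
    [Preadditive T] [∀ n : ℤ, (shiftFunctor T n).Additive] [Pretriangulated T]
    [IsTriangulated T] [HasCoproducts.{v} T]
    (A : ObjectProperty T) (hA_compact : A ≤ TriangulatedHeart.compact T)
    (hA_small : ObjectProperty.EssentiallySmall.{v} A)
    (hA_shift : ∀ X : T, A X → A ((shiftFunctor T (1 : ℤ)).obj X)) :
    ∃ t : TStructure T,
      -- `t` is the t-structure `(Coprod(A), Coprod(A)^⊥)`
      t.le 0 = TriangulatedHeart.coprod A ∧
      t.ge 1 = (TriangulatedHeart.coprod A).rightOrthogonal ∧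
      -- its heart is a locally finitely presented Grothendieck abelian category
      (∃ ab : Abelian (TriangulatedHeart.Heart t),
        ab.toPreadditive = (inferInstance : Preadditive (TriangulatedHeart.Heart t)) ∧
        IsGrothendieckAbelian.{v} (TriangulatedHeart.Heart t)) ∧
      IsLocallyFinitelyPresentable.{v} (TriangulatedHeart.Heart t) ∧
      -- its finitely presented objects are those isomorphic to `H⁰(c)`, `c` compact in `T^{≤ 0}`
      ObjectProperty.isFinitelyPresentable.{v} (TriangulatedHeart.Heart t) =
        (TriangulatedHeart.compact T ⊓ t.le 0).map (TriangulatedHeart.cohomologyZero t) := by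
  have h₀ : (TriangulatedHeart.generatedTStructure A hA_compact hA_small hA_shift).le 0 =
      TriangulatedHeart.coprod A := by
    ext X
    exact ((TriangulatedHeart.coprod A).prop_iff_of_iso ((shiftFunctorZero T ℤ).app X))
  refine ⟨TriangulatedHeart.generatedTStructure A hA_compact hA_small hA_shift, h₀, ?_,
    TriangulatedHeart.heart_of_le_eq_coprod hA_compact h₀⟩
  -- At index 1 the orthogonality condition is on `X⟦1 - 1⟧`, which is isomorphic to `X`.
  ext X
  exact ((TriangulatedHeart.coprod A).rightOrthogonal.prop_iff_of_iso
    ((shiftFunctorZero' T (1 - 1 : ℤ) (by lia)).app X))
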